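/- Let $\Bbbk$ be a field, let $d\ge 1$ and $0<r\le n$ be integers, and let $\underline q=(q_1,\dots,q_n)\in(\Bbbk^*)^n$ and $\underline{\widetilde q}=(\widetilde q_1,\dots,\widetilde q_r)\in(\Bbbk^*)^r$ satisfy $q_j^d\ne 1$ and $\widetilde q_i^{\,d}\neq 1$ for all $i,j$. Put $R=\{1,\dots,r\}$, $N=\{1,\dots,n\}$ and $a_d(u)=u^d-1$. Let $A(n,d,\underline q)=\bigotimes_{i=1}^n\Bbbk[h_i^{\pm1}](\sigma_i,h_i^d-1)$, $\sigma_i(h_i)=q_ih_i$, be the tensor product of generalized Weyl algebras; that is, the (associative unital) $\Bbbk$-algebra generated by $x_i,y_i,h_i,h_i^{-1}$ $(i\in N)$ subject to $$x_ih_i=q_ih_ix_i,\quad y_ih_i=q_i^{-1}h_iy_i,\quad x_iy_i=a_d(q_ih_i),\quad y_ix_i=a_d(h_i),\quad h_i^{\pm1}h_i^{\mp1}=1,$$ and, for $i\ne j$, $$h_ih_j=h_jh_i,\quad h_ix_j=x_jh_i,\quad h_iy_j=y_jh_i,\quad x_ix_j=x_jx_i,\quad x_iy_j=y_jx_i,\quad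 y_iy_j=y_jy_i .$$ Let $\widetilde A(r,d,\underline{\widetilde q})=A(r,d,\underline{\widetilde q})$, with generators written $\widetilde x_i,\widetilde y_i,\widetilde h_i^{\pm1}$ $(i\in R)$. Homomorphisms are unital $\Bbbk$-algebra homomorphisms. Consider data consisting of an injective map (partial permutation) $w:R\to N$, $(\tau_i)\in\{0,1\}^r$, $(m_i)\in(\mathbb Z\setminus\{0\})^r$, an integer matrix $(t_{i,j})\in\mathcal M_{r,n}(\mathbb Z)$, scalars $(\gamma_i),(b_i)\in(\Bbbk^*)^r$ and Laurent polynomials $(p_i),(p_i')\in(\Bbbk[h^{\pm1}])^r$, and the following conditions on them: $$q_{w(i)}^{(-1)^{\tau_i}m_i}=\widetilde q_i\quad\text{for all } i\in R, \tag{1}$$ $$q_{w(i)}^{t_{l,w(i)}(1-\tau_i)}\,q_{w(i)}^{-t_{l,w(i)}\tau_i}\,q_{w(l)}^{-t_{i,w(l)}(1-\tau_l)}\,q_{w(l)}^{t_{i,w(l)}\tau_l}=1\quad\text{for all } i,l\in R, \tag{2}$$ $$p_i(h_{w(i)})\,p_i'(h_{w(i)})\,a_d\big(q_{w(i)}^{1-\tau_i}h_{w(i)}\big)=a_d\big(\widetilde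 q_i\gamma_ih_{w(i)}^{m_i}\big)\ \text{ in }\Bbbk[h_{w(i)}^{\pm1}]\quad\text{for all } i\in R, \tag{3}$$ $$\gamma_i^d=\widetilde q_i^{\,-\tau_id}\quad\text{for all } i\in R. \tag{4}$$ 1. For every homomorphism $\psi:\widetilde A(r,d,\underline{\widetilde q})\to A(n,d,\underline q)$ there exist such data satisfying (1)–(4) for which, for all $i\in R$, $$\begin{aligned}\psi(\widetilde h_i)&=\gamma_ih_{w(i)}^{m_i},\\ \psi(\widetilde x_i)&=p_i(h_{w(i)})\,b_i\,h_1^{t_{i,1}}\cdots h_n^{t_{i,n}}\,x_{w(i)}^{1-\tau_i}y_{w(i)}^{\tau_i},\\ \psi(\widetilde y_i)&=x_{w(i)}^{\tau_i}y_{w(i)}^{1-\tau_i}\,p_i'(h_{w(i)})\,b_i^{-1}h_1^{-t_{i,1}}\cdots h_n^{-t_{i,n}}.\end{aligned}\tag{5}$$ 2. Conversely, for all such data satisfying (1)–(4) there exists a unique homomorphism $\psi:\widetilde A(r,d,\underline{\widetilde q})\to A(n,d,\underline q)$ satisfying (5) for all $i\in R$. -/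

import Mathlib

open scoped LaurentPolynomial

noncomputable section

/-- The expression `a_d(u) = u ^ d - 1`. -/
def aD {S : Type*} [Ring S] (d : ℕ) (u : S) : S := u ^ d - 1

namespace QWA

/-- The generators `x_i`, `y_i`, `h_i` and `h_i⁻¹`, for `i` in an index set of size `n`. -/
inductive Gen (n : ℕ) : Type
  | x (i : Fin n) : Gen n
  | y (i : Fin n) : Gen n
  | h (i : Fin n) : Gen n
  | hinv (i : Fin n) : Gen n

variable (k : Type*) [Field k]

/-- A generator, seen in the free algebra. -/
abbrev gen {n : ℕ} (g : Gen n) : FreeAlgebra k (Gen n) := FreeAlgebra.ι k g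

/-- The defining relations of the algebra `A(n, d, q)`. -/
inductive Rel (n d : ℕ) (q : Fin n → kˣ) : FreeAlgebra k (Gen n) → FreeAlgebra k (Gen n) → Prop
  | xh (i : Fin n) :
      Rel n d q (gen k (.x i) * gen k (.h i)) ((q i : k) • (gen k (.h i) * gen k (.x i)))
  | yh (i : Fin n) :
      Rel n d q (gen k (.y i) * gen k (.h i)) (((q i)⁻¹ : k) • (gen k (.h i) * gen k (.y i)))
  | xy (i : Fin n) :
      Rel n d q (gen k (.x i) * gen k (.y i)) (aD d ((q i : k) • gen k (.h i)))
  | yx (i : Fin n) :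
      Rel n d q (gen k (.y i) * gen k (.x i)) (aD d (gen k (.h i)))
  | h_hinv (i : Fin n) : Rel n d q (gen k (.h i) * gen k (.hinv i)) 1
  | hinv_h (i : Fin n) : Rel n d q (gen k (.hinv i) * gen k (.h i)) 1
  | comm_hh (i j : Fin n) (hij : i ≠ j) :
      Rel n d q (gen k (.h i) * gen k (.h j)) (gen k (.h j) * gen k (.h i))
  | comm_hx (i j : Fin n) (hij : i ≠ j) :
      Rel n d q (gen k (.h i) * gen k (.x j)) (gen k (.x j) * gen k (.h i))
  | comm_hy (i j : Fin n) (hij : i ≠ j) :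
      Rel n d q (gen k (.h i) * gen k (.y j)) (gen k (.y j) * gen k (.h i))
  | comm_xx (i j : Fin n) (hij : i ≠ j) :
      Rel n d q (gen k (.x i) * gen k (.x j)) (gen k (.x j) * gen k (.x i))
  | comm_xy (i j : Fin n) (hij : i ≠ j) :
      Rel n d q (gen k (.x i) * gen k (.y j)) (gen k (.y j) * gen k (.x i))
  | comm_yy (i j : Fin n) (hij : i ≠ j) :
      Rel n d q (gen k (.y i) * gen k (.y j)) (gen k (.y j) * gen k (.y i))

end QWA

/-- The quantum Weyl analogue algebra `A(n, d, q)`: the `k`-algebra generated by `x_i`, `y_i`,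
`h_i`, `h_i⁻¹` subject to the relations `QWA.Rel`. It is the tensor product over `i` of the
generalized Weyl algebras `k[h_i^{±1}](σ_i, h_i ^ d - 1)` with `σ_i(h_i) = q_i h_i`. -/
def QWA (k : Type*) [Field k] (n d : ℕ) (q : Fin n → kˣ) : Type _ :=
  RingQuot (QWA.Rel k n d q)

namespace QWA

variable {k : Type*} [Field k] {n d : ℕ} {q : Fin n → kˣ}

instance : Ring (QWA k n d q) := inferInstanceAs (Ring (RingQuot (QWA.Rel k n d q)))

instance : Algebra k (QWA k n d q) := inferInstanceAs (Algebra k (RingQuot (QWA.Rel k n d q)))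

/-- The quotient map from the free algebra. -/
def mk : FreeAlgebra k (Gen n) →ₐ[k] QWA k n d q := RingQuot.mkAlgHom k (QWA.Rel k n d q)

/-- The generator `x_i`. -/
def x (i : Fin n) : QWA k n d q := mk (gen k (.x i))

/-- The generator `y_i`. -/
def y (i : Fin n) : QWA k n d q := mk (gen k (.y i))

/-- The generator `h_i`, as a unit, with inverse the generator `h_i⁻¹`. -/
def h (i : Fin n) : (QWA k n d q)ˣ where
  val := mk (gen k (.h i))
  inv := mk (gen k (.hinv i))
  val_inv := by
    rw [← map_mul, ← map_one (mk (k := k) (n := n) (d := d) (q := q))]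
    exact RingQuot.mkAlgHom_rel k (Rel.h_hinv i)
  inv_val := by
    rw [← map_mul, ← map_one (mk (k := k) (n := n) (d := d) (q := q))]
    exact RingQuot.mkAlgHom_rel k (Rel.hinv_h i)

/-- The monomial `h_1 ^ s_1 ⋯ h_n ^ s_n`, the factors taken in this order. -/
def hMon (s : Fin n → ℤ) : QWA k n d q :=
  (((List.ofFn fun j => (h j : (QWA k n d q)ˣ) ^ s j).prod : (QWA k n d q)ˣ) : QWA k n d q)

/-- The element `p(h_j)`, for a Laurent polynomial `p` over `k` in one variable: the `k`-algebra
homomorphism that sends the variable `T` to `h_j`. -/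
def evalH (j : Fin n) : k[T;T⁻¹] →ₐ[k] QWA k n d q :=
  AddMonoidAlgebra.lift k (QWA k n d q) ℤ
    ((Units.coeHom (QWA k n d q)).comp (zpowersHom (QWA k n d q)ˣ (h j)))

/-- The parameters of a homomorphism from `A(r, d, qt)` to `A(n, d, q)`. The partial permutation
`w` is an injective map, and `τ i` is `0` or `1`. -/
structure HomDatum (k : Type*) [Field k] (r n : ℕ) where
  w : Fin r ↪ Fin n
  τ : Fin r → Fin 2
  m : Fin r → ℤ
  t : Matrix (Fin r) (Fin n) ℤ
  γ : Fin r → kˣ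
  b : Fin r → kˣ
  p : Fin r → k[T;T⁻¹]
  p' : Fin r → k[T;T⁻¹]

namespace HomDatum

variable {r : ℕ}

/-- The conditions on the parameters. -/
structure Admissible (D : HomDatum k r n) (d : ℕ) (qt : Fin r → kˣ) (q : Fin n → kˣ) : Prop where
  m_ne_zero : ∀ i, D.m i ≠ 0
  q_pow : ∀ i, q (D.w i) ^ ((-1) ^ (D.τ i : ℕ) * D.m i) = qt i
  compat : ∀ i l,
    q (D.w i) ^ (D.t l (D.w i) * (1 - ((D.τ i : ℕ) : ℤ))) *
      q (D.w i) ^ (-D.t l (D.w i) * ((D.τ i : ℕ) : ℤ)) *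
      q (D.w l) ^ (-D.t i (D.w l) * (1 - ((D.τ l : ℕ) : ℤ))) *
      q (D.w l) ^ (D.t i (D.w l) * ((D.τ l : ℕ) : ℤ)) = 1
  factor : ∀ i,
    D.p i * D.p' i *
        aD d (LaurentPolynomial.C ((q (D.w i) : k) ^ (1 - (D.τ i : ℕ))) * LaurentPolynomial.T 1) =
      aD d (LaurentPolynomial.C ((qt i : k) * (D.γ i : k)) * LaurentPolynomial.T (D.m i))
  γ_pow : ∀ i, D.γ i ^ d = qt i ^ (-(((D.τ i : ℕ) : ℤ) * (d : ℤ)))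

/-- The homomorphism `ψ` is given on the generators by the parameters `D`. -/
structure Implements (D : HomDatum k r n) {qt : Fin r → kˣ}
    (ψ : QWA k r d qt →ₐ[k] QWA k n d q) : Prop where
  map_h : ∀ i,
    ψ ((h i : (QWA k r d qt)ˣ) : QWA k r d qt) =
      (D.γ i : k) • (((h (D.w i)) ^ D.m i : (QWA k n d q)ˣ) : QWA k n d q)
  map_x : ∀ i,
    ψ (x i) =
      evalH (D.w i) (D.p i) * ((D.b i : k) • hMon (D.t i)) *
        (x (D.w i) ^ (1 - (D.τ i : ℕ)) * y (D.w i) ^ (D.τ i : ℕ))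
  map_y : ∀ i,
    ψ (y i) =
      (x (D.w i) ^ (D.τ i : ℕ) * y (D.w i) ^ (1 - (D.τ i : ℕ))) *
        evalH (D.w i) (D.p' i) * (((D.b i)⁻¹ : k) • hMon fun j => -D.t i j)

end HomDatum

end QWA

end

noncomputable section

/-- If every pair of elements of `A` and `B` with a unique product has the same product, then
`A` and `B` are singletons. -/
@[to_additive
/-- If every pair of elements of `A` and `B` with a unique sum has the same sum, then
`A` and `B` are singletons. -/]
theorem TwoUniqueProds.exists_eq_singleton {G : Type*} [Mul G] [TwoUniqueProds G]
    {A B : Finset G} (hA : A.Nonempty) (hB : B.Nonempty) (g : G)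
    (h : ∀ a ∈ A, ∀ b ∈ B, UniqueMul A B a b → a * b = g) :
    ∃ a b, A = {a} ∧ B = {b} := by
  by_cases hc : 1 < A.card * B.card
  · obtain ⟨p₁, h₁, p₂, h₂, hne, hu₁, hu₂⟩ := TwoUniqueProds.uniqueMul_of_one_lt_card hc
    rw [Finset.mem_product] at h₁ h₂
    have e := (h _ h₁.1 _ h₁.2 hu₁).trans (h _ h₂.1 _ h₂.2 hu₂).symm
    obtain ⟨e₁, e₂⟩ := hu₂ h₁.1 h₁.2 e
    exact absurd (Prod.ext e₁ e₂) hne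
  · have hA' := hA.card_pos
    have hB' := hB.card_pos
    have h1 : A.card = 1 := by nlinarith
    have h2 : B.card = 1 := by nlinarith
    obtain ⟨a, ha⟩ := Finset.card_eq_one.1 h1
    obtain ⟨b, hb⟩ := Finset.card_eq_one.1 h2
    exact ⟨a, b, ha, hb⟩

namespace SkewMonoidAlgebra

variable {R G : Type*} [Ring R] [Group G] [MulSemiringAction G R]

theorem coeff_mul_mul_of_uniqueMul {f g : SkewMonoidAlgebra R G} {a b : G}
    (h : UniqueMul f.support g.support a b) :
    (f * g).coeff (a * b) = f.coeff a * a • g.coeff b := by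
  classical
  simp_rw [coeff_mul, sum_def', ← Finset.sum_product']
  refine (Finset.sum_eq_single (a, b) ?_ ?_).trans (if_pos rfl) <;> simp_rw [Finset.mem_product]
  · refine fun ab hab hne ↦ if_neg (fun he ↦ hne <| Prod.ext ?_ ?_)
    exacts [(h hab.1 hab.2 he).1, (h hab.1 hab.2 he).2]
  · refine fun hnotMem ↦ ite_eq_right_iff.mpr (fun _ ↦ ?_)
    rcases not_and_or.mp hnotMem with af | bg
    · rw [notMem_support_iff.mp af, zero_mul]
    · rw [notMem_support_iff.mp bg, smul_zero, mul_zero]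

theorem eq_single_of_support_eq {R G : Type*} [Ring R] {f : SkewMonoidAlgebra R G} {a : G} (h : f.support = {a}) :
    f = single a (f.coeff a) := by
  classical
  ext b
  rw [coeff_single_apply]
  split_ifs with hb
  · rw [hb]
  · rw [← notMem_support_iff, h, Finset.mem_singleton]
    exact fun e ↦ hb e.symm

theorem exists_single_of_mul_eq_single [NoZeroDivisors R] [TwoUniqueProds G]
    {f g : SkewMonoidAlgebra R G} {c : G} {r : R} (hr : r ≠ 0) (h : f * g = single c r) :
    ∃ a b s t, f = single a s ∧ g = single b t ∧ a * b = c ∧ s * a • t = r := by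
  classical
  have hfg : f * g ≠ 0 := by rw [h]; exact fun e ↦ hr (single_eq_zero.1 e)
  have hf : f.support.Nonempty := by
    rw [Finset.nonempty_iff_ne_empty, Ne, support_eq_empty]; exact left_ne_zero_of_mul hfg
  have hg : g.support.Nonempty := by
    rw [Finset.nonempty_iff_ne_empty, Ne, support_eq_empty]; exact right_ne_zero_of_mul hfg
  obtain ⟨a, b, ha, hb⟩ := TwoUniqueProds.exists_eq_singleton hf hg c (by
    intro a ha b hb hu
    have := coeff_mul_mul_of_uniqueMul hu
    rw [mem_support_iff] at ha hb
    have hne : f.coeff a * a • g.coeff b ≠ 0 :=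
      mul_ne_zero ha (by rwa [Ne, smul_eq_zero_iff_eq])
    rw [← this, h, coeff_single_apply] at hne
    by_contra hc
    exact hne (if_neg fun e ↦ hc e.symm))
  have ef := eq_single_of_support_eq ha
  have eg := eq_single_of_support_eq hb
  have hprod : single (a * b) (f.coeff a * a • g.coeff b) = single c r := by
    rw [← single_mul_single, ← ef, ← eg, h]
  have hab : a * b = c := by
    by_contra hne
    have := congrArg (fun F ↦ coeff F c) hprod
    simp only [coeff_single_apply, if_neg hne, if_true] at this
    exact hr this.symm
  subst hab
  exact ⟨a, b, _, _, ef, eg, rfl, single_injective _ hprod⟩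

end SkewMonoidAlgebra

namespace AddMonoidAlgebra

variable {R G : Type*} [Ring R] [AddGroup G]

theorem eq_single_of_support_eq {R G : Type*} [Ring R] {f : AddMonoidAlgebra R G} {a : G} (h : f.coeff.support = {a}) :
    f = single a (f.coeff a) := by
  classical
  ext b
  rw [coeff_single, Finsupp.single_apply]
  split_ifs with hb
  · rw [hb]
  · rw [← Finsupp.notMem_support_iff, h, Finset.mem_singleton]
    exact fun e ↦ hb e.symm

theorem exists_single_of_mul_eq_single [NoZeroDivisors R] [TwoUniqueSums G]
    {f g : AddMonoidAlgebra R G} {c : G} {r : R} (hr : r ≠ 0) (h : f * g = single c r) :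
    ∃ a b s t, f = single a s ∧ g = single b t ∧ a + b = c ∧ s * t = r := by
  classical
  have hfg : f * g ≠ 0 := by rw [h]; simpa using hr
  have hf : f.coeff.support.Nonempty := by
    rw [Finset.nonempty_iff_ne_empty, Ne, Finsupp.support_eq_empty, coeff_eq_zero]
    exact left_ne_zero_of_mul hfg
  have hg : g.coeff.support.Nonempty := by
    rw [Finset.nonempty_iff_ne_empty, Ne, Finsupp.support_eq_empty, coeff_eq_zero]
    exact right_ne_zero_of_mul hfg
  obtain ⟨a, b, ha, hb⟩ := TwoUniqueSums.exists_eq_singleton hf hg c (by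
    intro a ha b hb hu
    have := coeff_mul_add_of_uniqueAdd hu
    rw [Finsupp.mem_support_iff] at ha hb
    have hne : f.coeff a * g.coeff b ≠ 0 := mul_ne_zero ha hb
    rw [← this, h, coeff_single, Finsupp.single_apply] at hne
    by_contra hc
    exact hne (if_neg fun e ↦ hc e.symm))
  have ef := eq_single_of_support_eq ha
  have eg := eq_single_of_support_eq hb
  have hprod : single (a + b) (f.coeff a * g.coeff b) = single c r := by
    rw [← single_mul_single, ← ef, ← eg, h]
  have hab : a + b = c := by
    by_contra hne
    have := congrArg (fun F ↦ coeff F c) hprod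
    simp only [coeff_single, Finsupp.single_apply, if_neg hne, if_true] at this
    exact hr this.symm
  subst hab
  exact ⟨a, b, _, _, ef, eg, rfl, by simpa using congrArg (fun F ↦ coeff F (a + b)) hprod⟩

end AddMonoidAlgebra

/-- Laurent polynomials over `k` in `n` commuting variables. -/
abbrev MvLaurent (k : Type*) [Field k] (n : ℕ) : Type _ := AddMonoidAlgebra k (Fin n → ℤ)

namespace MvLaurent

open AddMonoidAlgebra

variable {k : Type*} [Field k] {n : ℕ}

/-- The bicharacter `∏ q_j ^ (v_j s_j)`. -/
def chi (q : Fin n → kˣ) (v s : Fin n → ℤ) : kˣ := ∏ j, q j ^ (v j * s j)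

theorem chi_zero_left (q : Fin n → kˣ) (s) : chi q 0 s = 1 := by simp [chi]

theorem chi_zero_right (q : Fin n → kˣ) (v) : chi q v 0 = 1 := by simp [chi]

theorem chi_add_left (q : Fin n → kˣ) (v w s) : chi q (v + w) s = chi q v s * chi q w s := by
  simp [chi, add_mul, zpow_add, Finset.prod_mul_distrib]

theorem chi_add_right (q : Fin n → kˣ) (v s t) : chi q v (s + t) = chi q v s * chi q v t := by
  simp [chi, mul_add, zpow_add, Finset.prod_mul_distrib]

theorem chi_single_left (q : Fin n → kˣ) (j m s) :
    chi q (Pi.single j m) s = q j ^ (m * s j) := by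
  rw [chi, Finset.prod_eq_single j]
  · simp
  · intro i _ hi; simp [Pi.single_eq_of_ne hi]
  · simp

theorem chi_single_right (q : Fin n → kˣ) (v j m) :
    chi q v (Pi.single j m) = q j ^ (v j * m) := by
  rw [chi, Finset.prod_eq_single j]
  · simp
  · intro i _ hi; simp [Pi.single_eq_of_ne hi]
  · simp

/-- Algebra homomorphisms out of the Laurent polynomials, given by a monomial for each exponent. -/
def monomialHom {M A : Type*} [AddCommGroup M] [CommRing A] [Algebra k A]
    (f : (Fin n → ℤ) →+ M) (c : (Fin n → ℤ) → A) (h0 : c 0 = 1)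
    (hadd : ∀ s t, c (s + t) = c s * c t) :
    MvLaurent k n →ₐ[k] AddMonoidAlgebra A M :=
  AddMonoidAlgebra.lift k _ _
    { toFun := fun s ↦ single (f s.toAdd) (c s.toAdd)
      map_one' := by simp [h0, one_def]
      map_mul' := fun s t ↦ by simp [hadd, single_mul_single] }

theorem monomialHom_single {M A : Type*} [AddCommGroup M] [CommRing A] [Algebra k A]
    (f : (Fin n → ℤ) →+ M) (c : (Fin n → ℤ) → A) (h0 hadd) (s a) :
    monomialHom (k := k) f c h0 hadd (single s a) = single (f s) (a • c s) := by
  simp [monomialHom, AddMonoidAlgebra.lift_single]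

/-- The automorphism `h_j ↦ q_j ^ (v_j) h_j` of the Laurent polynomials. -/
def twist (q : Fin n → kˣ) (v : Fin n → ℤ) : MvLaurent k n →ₐ[k] MvLaurent k n :=
  monomialHom (AddMonoidHom.id _) (fun s ↦ (chi q v s : k)) (by simp [chi_zero_right])
    (fun s t ↦ by simp [chi_add_right])

theorem twist_single (q : Fin n → kˣ) (v s a) :
    twist q v (single s a) = single s (a * chi q v s : k) := by
  rw [twist, monomialHom_single]; rfl

theorem algHom_ext_single {A : Type*} [Semiring A] [Algebra k A] {f g : MvLaurent k n →ₐ[k] A}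
    (h : ∀ s, f (single s 1) = g (single s 1)) : f = g := by
  refine (AddMonoidAlgebra.lift k A _).symm.injective ?_
  ext s
  exact h _

theorem twist_zero (q : Fin n → kˣ) : twist q 0 = AlgHom.id k (MvLaurent k n) :=
  algHom_ext_single fun s ↦ by simp [twist_single, chi_zero_left]

theorem twist_add (q : Fin n → kˣ) (v w f) : twist q (v + w) f = twist q v (twist q w f) := by
  have : twist q (v + w) = (twist q v).comp (twist q w) :=
    algHom_ext_single fun s ↦ by simp [twist_single, chi_add_left, mul_comm]
  rw [this]; rfl

theorem twist_neg_twist (q : Fin n → kˣ) (v f) : twist q (-v) (twist q v f) = f := by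
  rw [← twist_add, neg_add_cancel, twist_zero]; rfl

theorem twist_injective (q : Fin n → kˣ) (v) : Function.Injective (twist q v) :=
  Function.LeftInverse.injective (twist_neg_twist q v)

/-- The exponents, with the one at `j` set to zero. -/
def forget (j : Fin n) : (Fin n → ℤ) →+ (Fin n → ℤ) where
  toFun s := Function.update s j 0
  map_zero' := by ext i; by_cases h : i = j <;> simp [h]
  map_add' s t := by ext i; by_cases h : i = j <;> simp [h]

theorem forget_single (j : Fin n) (m : ℤ) : forget j (Pi.single j m) = 0 := by
  ext i; by_cases h : i = j <;> simp [forget, h]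

theorem single_add_forget (j : Fin n) (s : Fin n → ℤ) : Pi.single j (s j) + forget j s = s := by
  ext i
  by_cases h : i = j
  · subst h; simp [forget]
  · simp [forget, h]

/-- Substitution of the scalar `c` for `h_j`. -/
def spec (j : Fin n) (c : kˣ) : MvLaurent k n →ₐ[k] MvLaurent k n :=
  monomialHom (forget j) (fun s ↦ ((c ^ s j : kˣ) : k)) (by simp) (fun s t ↦ by simp [zpow_add])

theorem spec_single (j : Fin n) (c : kˣ) (s a) :
    spec j c (single s a) = single (forget j s) (a * (c ^ s j : kˣ) : k) := by
  rw [spec, monomialHom_single]; rfl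

/-- The inclusion of the Laurent polynomials in `h_j`. -/
def incl (j : Fin n) : k[T;T⁻¹] →ₐ[k] MvLaurent k n :=
  AddMonoidAlgebra.mapDomainAlgHom k k (AddMonoidHom.single (fun _ ↦ ℤ) j)

theorem incl_single (j : Fin n) (m : ℤ) (a : k) :
    incl j (single m a) = (single (Pi.single j m) a : MvLaurent k n) :=
  AddMonoidAlgebra.mapDomain_single

/-- Laurent polynomials in `n` variables as Laurent polynomials in the variables other than `h_j`
whose coefficients are Laurent polynomials in `h_j`. -/
def split (j : Fin n) : MvLaurent k n →ₐ[k] AddMonoidAlgebra k[T;T⁻¹] (Fin n → ℤ) :=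
  monomialHom (forget j) (fun s ↦ (LaurentPolynomial.T (s j) : k[T;T⁻¹])) (by simp)
    (fun s t ↦ LaurentPolynomial.T_add _ _)

theorem split_single (j : Fin n) (s a) :
    split j (single s a : MvLaurent k n) = single (forget j s) (single (s j) a) :=
  (monomialHom_single _ _ _ _ s a).trans <| by
    rw [LaurentPolynomial.T, smul_single, smul_eq_mul, mul_one]

theorem split_incl (j : Fin n) (p : k[T;T⁻¹]) :
    split j (incl j p : MvLaurent k n) = single 0 p := by
  induction p using AddMonoidAlgebra.induction_linear with
  | zero => simp
  | add p p' hp hp' => simp [hp, hp']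
  | single m a => rw [incl_single, split_single, forget_single]; simp

/-- The inverse of `split`. -/
def glue (j : Fin n) : AddMonoidAlgebra k[T;T⁻¹] (Fin n → ℤ) →+ MvLaurent k n :=
  AddMonoidAlgebra.liftNC ((incl j : k[T;T⁻¹] →ₐ[k] MvLaurent k n) : k[T;T⁻¹] →+ MvLaurent k n) (fun g ↦ single g.toAdd 1)

theorem glue_single (j : Fin n) (g : Fin n → ℤ) (p : k[T;T⁻¹]) :
    glue j (single g p) = incl j p * single g 1 := by
  simp [glue]

theorem glue_split (j : Fin n) (f : MvLaurent k n) : glue j (split j f) = f := by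
  induction f using AddMonoidAlgebra.induction_linear with
  | zero => simp
  | add p p' hp hp' => simp [hp, hp']
  | single m a =>
    rw [split_single, glue_single, incl_single, single_mul_single, single_add_forget, mul_one]

/-- A factorization of a nonzero Laurent polynomial in the single variable `h_j` comes, up to
monomials, from Laurent polynomials in `h_j`. -/
theorem exists_incl_of_mul_eq_incl (j : Fin n) {a b : MvLaurent k n} {u w : k[T;T⁻¹]}
    (hw : w ≠ 0) (h : a * b * incl j u = incl j w) :
    ∃ p p' t, a = incl j p * single t 1 ∧ b = incl j p' * single (-t) 1 ∧ p * p' * u = w := by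
  have h' := congrArg (split j) h
  rw [map_mul, map_mul, split_incl, split_incl] at h'
  obtain ⟨c, e, r, r', hab, hu, hce, hrr⟩ := exists_single_of_mul_eq_single hw h'
  have hu' : e = 0 ∧ r' = u := by
    have hr' : r' ≠ 0 := by rintro rfl; simp at hrr; exact hw hrr.symm
    have h1 : e = 0 := by
      by_contra hne
      have := congrArg (fun F ↦ coeff F e) hu
      simp only [coeff_single, Finsupp.single_apply, if_neg (Ne.symm hne), if_true] at this
      exact hr' this.symm
    subst h1
    exact ⟨rfl, by simpa using (congrArg (fun F ↦ coeff F 0) hu).symm⟩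
  obtain ⟨rfl, rfl⟩ := hu'
  have hr : r ≠ 0 := by rintro rfl; simp at hrr; exact hw hrr.symm
  obtain ⟨s, t, p, p', ha, hb, hst, hpp⟩ := exists_single_of_mul_eq_single hr hab
  have ht : t = -s := by
    rw [add_zero] at hce; rw [hce] at hst; exact eq_neg_of_add_eq_zero_right hst
  subst ht
  refine ⟨p, p', s, ?_, ?_, by rw [hpp, hrr]⟩
  · rw [← glue_split j a, ha, glue_single]
  · rw [← glue_split j b, hb, glue_single]

theorem exists_single_of_mul_eq_one {a b : MvLaurent k n} (h : a * b = 1) :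
    ∃ s, ∃ c : kˣ, a = single s (c : k) := by
  rw [one_def] at h
  obtain ⟨s, t, c, c', ha, -, -, hc⟩ := exists_single_of_mul_eq_single one_ne_zero h
  exact ⟨s, Units.mk0 c (left_ne_zero_of_mul (hc ▸ one_ne_zero)), ha⟩

end MvLaurent

section ListOfFn

variable {M : Type*} [Monoid M]

theorem List.mul_prod_ofFn {n : ℕ} (f : Fin n → M) (j : Fin n) (a : M)
    (h : ∀ i, i ≠ j → Commute a (f i)) :
    a * (List.ofFn f).prod = (List.ofFn (Function.update f j (a * f j))).prod := by
  induction n with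
  | zero => exact j.elim0
  | succ n ih =>
    rw [List.ofFn_succ, List.ofFn_succ, List.prod_cons, List.prod_cons]
    refine Fin.cases (fun h ↦ ?_) (fun j h ↦ ?_) j h
    · rw [Function.update_self, mul_assoc]
      congr 4
    · rw [Function.update_of_ne (Fin.succ_ne_zero j).symm, ← mul_assoc,
        (h 0 (Fin.succ_ne_zero j).symm).eq, mul_assoc,
        ih (fun i ↦ f i.succ) j fun i hi ↦ h _ fun e ↦ hi (Fin.succ_injective _ e)]
      congr 4
      ext i
      by_cases hi : i = j
      · subst hi; simp
      · rw [Function.update_of_ne hi, Function.update_of_ne fun e ↦ hi (Fin.succ_injective _ e)]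

theorem List.prod_ofFn_mul_prod_ofFn {n : ℕ} (f g : Fin n → M) (h : ∀ i j, Commute (g i) (f j)) :
    (List.ofFn fun i ↦ f i * g i).prod = (List.ofFn f).prod * (List.ofFn g).prod := by
  induction n with
  | zero => simp
  | succ n ih =>
    simp only [List.ofFn_succ, List.prod_cons]
    rw [ih (fun i ↦ f i.succ) (fun i ↦ g i.succ) fun i j ↦ h _ _]
    have : Commute (g 0) (List.ofFn fun i ↦ f i.succ).prod :=
      Commute.list_prod_right _ _ fun y hy ↦ by
        obtain ⟨i, rfl⟩ := List.mem_ofFn.1 hy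
        exact h _ _
    rw [mul_assoc, mul_assoc, ← mul_assoc (g 0), this.eq]
    simp only [mul_assoc]

theorem List.prod_ofFn_one {n : ℕ} : (List.ofFn fun _ : Fin n ↦ (1 : M)).prod = 1 := by
  simp

theorem List.prod_ofFn_update_one {n : ℕ} (j : Fin n) (a : M) :
    (List.ofFn (Function.update (fun _ ↦ 1) j a)).prod = a := by
  have := List.mul_prod_ofFn (fun _ : Fin n ↦ (1 : M)) j a fun i _ ↦ Commute.one_right a
  rw [List.prod_ofFn_one, mul_one] at this
  exact this.symm

end ListOfFn

theorem map_aD {S S' F : Type*} [Ring S] [Ring S'] [FunLike F S S'] [RingHomClass F S S']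
    (f : F) (d : ℕ) (u : S) : f (aD d u) = aD d (f u) := by
  simp [aD]

namespace QWA

variable {k : Type*} [Field k] {n d : ℕ} {q : Fin n → kˣ}

/-- Families of elements that satisfy the defining relations of `A(n, d, q)`. -/
structure IsFamily {B : Type*} [Ring B] [Algebra k B] (n d : ℕ) (q : Fin n → kˣ)
    (X Y : Fin n → B) (H : Fin n → Bˣ) : Prop where
  xh : ∀ i, X i * H i = (q i : k) • (H i * X i : B)
  yh : ∀ i, Y i * H i = ((q i)⁻¹ : k) • (H i * Y i : B)
  xy : ∀ i, X i * Y i = aD d ((q i : k) • (H i : B))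
  yx : ∀ i, Y i * X i = aD d (H i : B)
  comm_hh : ∀ i j, i ≠ j → (H i * H j : B) = H j * H i
  comm_hx : ∀ i j, i ≠ j → (H i * X j : B) = X j * H i
  comm_hy : ∀ i j, i ≠ j → (H i * Y j : B) = Y j * H i
  comm_xx : ∀ i j, i ≠ j → X i * X j = X j * X i
  comm_xy : ∀ i j, i ≠ j → X i * Y j = Y j * X i
  comm_yy : ∀ i j, i ≠ j → Y i * Y j = Y j * Y i

section Lift

variable {B : Type*} [Ring B] [Algebra k B]

/-- The images of the generators. -/
def genImage (X Y : Fin n → B) (H : Fin n → Bˣ) : Gen n → B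
  | .x i => X i
  | .y i => Y i
  | .h i => H i
  | .hinv i => ((H i)⁻¹ : Bˣ)

/-- The universal property of `A(n, d, q)`. -/
def liftHom (X Y : Fin n → B) (H : Fin n → Bˣ) (hF : IsFamily n d q X Y H) : QWA k n d q →ₐ[k] B :=
  RingQuot.liftAlgHom k ⟨FreeAlgebra.lift k (genImage X Y H), by
    intro a b hab
    induction hab with
    | xh i => simpa [genImage] using hF.xh i
    | yh i => simpa [genImage] using hF.yh i
    | xy i => simpa [genImage, map_aD] using hF.xy i
    | yx i => simpa [genImage, map_aD] using hF.yx i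
    | h_hinv i => simp [genImage]
    | hinv_h i => simp [genImage]
    | comm_hh i j hij => simpa [genImage] using hF.comm_hh i j hij
    | comm_hx i j hij => simpa [genImage] using hF.comm_hx i j hij
    | comm_hy i j hij => simpa [genImage] using hF.comm_hy i j hij
    | comm_xx i j hij => simpa [genImage] using hF.comm_xx i j hij
    | comm_xy i j hij => simpa [genImage] using hF.comm_xy i j hij
    | comm_yy i j hij => simpa [genImage] using hF.comm_yy i j hij⟩

variable (X Y : Fin n → B) (H : Fin n → Bˣ) (hF : IsFamily n d q X Y H)

theorem liftHom_mk (a : FreeAlgebra k (Gen n)) :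
    liftHom X Y H hF (mk a) = FreeAlgebra.lift k (genImage X Y H) a :=
  RingQuot.liftAlgHom_mkAlgHom_apply _ _ _ _

theorem liftHom_x (i : Fin n) : liftHom X Y H hF (x i) = X i := by
  rw [x, liftHom_mk]; simp [genImage]

theorem liftHom_y (i : Fin n) : liftHom X Y H hF (y i) = Y i := by
  rw [y, liftHom_mk]; simp [genImage]

theorem liftHom_h (i : Fin n) : liftHom X Y H hF (h i : (QWA k n d q)ˣ) = H i := by
  rw [h, liftHom_mk]; simp [genImage]

end Lift

theorem mk_surjective : Function.Surjective (mk : _ →ₐ[k] QWA k n d q) :=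
  RingQuot.mkAlgHom_surjective k _

theorem hom_ext {B : Type*} [Ring B] [Algebra k B] {f g : QWA k n d q →ₐ[k] B}
    (hx : ∀ i, f (x i) = g (x i)) (hy : ∀ i, f (y i) = g (y i))
    (hh : ∀ i, f (h i : (QWA k n d q)ˣ) = g (h i : (QWA k n d q)ˣ)) : f = g := by
  have hinv : ∀ i, f ((h i)⁻¹ : (QWA k n d q)ˣ) = g ((h i)⁻¹ : (QWA k n d q)ˣ) := by
    intro i
    have : Units.map (f : QWA k n d q →* B) (h i) = Units.map (g : QWA k n d q →* B) (h i) :=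
      Units.ext (hh i)
    have h2 := congrArg (fun u : Bˣ ↦ ((u⁻¹ : Bˣ) : B)) this
    simpa [← map_inv] using h2
  have : f.comp mk = g.comp mk := by
    ext z
    cases z with
    | x i => exact hx i
    | y i => exact hy i
    | h i => exact hh i
    | hinv i => exact hinv i
  ext a
  obtain ⟨a, rfl⟩ := mk_surjective a
  exact DFunLike.congr_fun this a

section Relations

theorem mk_rel {a b : FreeAlgebra k (Gen n)} (hab : Rel k n d q a b) :
    (mk a : QWA k n d q) = mk b :=
  RingQuot.mkAlgHom_rel k hab

theorem isFamily_gens : IsFamily n d q (x : Fin n → QWA k n d q) y h where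
  xh i := by
    have := mk_rel (Rel.xh (d := d) (q := q) i)
    rwa [map_smul, map_mul, map_mul] at this
  yh i := by
    have := mk_rel (Rel.yh (d := d) (q := q) i)
    rwa [map_smul, map_mul, map_mul] at this
  xy i := by
    have := mk_rel (Rel.xy (d := d) (q := q) i)
    rwa [map_mul, map_aD, map_smul] at this
  yx i := by
    have := mk_rel (Rel.yx (d := d) (q := q) i)
    rwa [map_mul, map_aD] at this
  comm_hh i j hij := by
    have := mk_rel (Rel.comm_hh (d := d) (q := q) i j hij)
    rwa [map_mul, map_mul] at this
  comm_hx i j hij := by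
    have := mk_rel (Rel.comm_hx (d := d) (q := q) i j hij)
    rwa [map_mul, map_mul] at this
  comm_hy i j hij := by
    have := mk_rel (Rel.comm_hy (d := d) (q := q) i j hij)
    rwa [map_mul, map_mul] at this
  comm_xx i j hij := by
    have := mk_rel (Rel.comm_xx (d := d) (q := q) i j hij)
    rwa [map_mul, map_mul] at this
  comm_xy i j hij := by
    have := mk_rel (Rel.comm_xy (d := d) (q := q) i j hij)
    rwa [map_mul, map_mul] at this
  comm_yy i j hij := by
    have := mk_rel (Rel.comm_yy (d := d) (q := q) i j hij)
    rwa [map_mul, map_mul] at this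

theorem h_commute (i j : Fin n) : Commute (h i : (QWA k n d q)ˣ) (h j) := by
  rcases eq_or_ne i j with rfl | hij
  · exact Commute.refl _
  · exact Units.ext (isFamily_gens.comm_hh i j hij)

theorem hMon_zero : (hMon 0 : QWA k n d q) = 1 := by simp [hMon]

theorem hMon_add (s t : Fin n → ℤ) : (hMon (s + t) : QWA k n d q) = hMon s * hMon t := by
  rw [hMon, hMon, hMon, ← Units.val_mul, ← List.prod_ofFn_mul_prod_ofFn]
  · simp only [Pi.add_apply, zpow_add]
  · exact fun i j ↦ ((h_commute i j).zpow_left _).zpow_right _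

theorem hMon_single (j : Fin n) (m : ℤ) :
    (hMon (Pi.single j m) : QWA k n d q) = ((h j ^ m : (QWA k n d q)ˣ) : QWA k n d q) := by
  rw [hMon, ← List.prod_ofFn_update_one j (h j ^ m : (QWA k n d q)ˣ)]
  congr 3
  ext i : 1
  by_cases hi : i = j
  · subst hi; simp
  · simp [hi]

/-- The inclusion of the Laurent polynomials in `h_1, …, h_n`. -/
def evalAll : MvLaurent k n →ₐ[k] QWA k n d q :=
  AddMonoidAlgebra.lift k (QWA k n d q) (Fin n → ℤ)
    { toFun := fun s ↦ hMon s.toAdd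
      map_one' := hMon_zero
      map_mul' := fun _ _ ↦ hMon_add _ _ }

theorem evalAll_single (s : Fin n → ℤ) (a : k) :
    evalAll (.single s a) = a • (hMon s : QWA k n d q) := by
  simp [evalAll, AddMonoidAlgebra.lift_single]

theorem evalH_eq (j : Fin n) (p : k[T;T⁻¹]) :
    (evalH j p : QWA k n d q) = evalAll (MvLaurent.incl j p) := by
  induction p using AddMonoidAlgebra.induction_linear with
  | zero => simp
  | add p p' hp hp' => simp only [map_add, hp, hp']
  | single m a =>
    rw [MvLaurent.incl_single, evalAll_single, hMon_single, evalH, AddMonoidAlgebra.lift_single]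
    rfl

theorem evalAll_h (j : Fin n) :
    (evalAll (.single (Pi.single j 1) 1) : QWA k n d q) = (h j : (QWA k n d q)ˣ) := by
  rw [evalAll_single, hMon_single, one_smul, zpow_one]

/-- The scalar `c` as a unit. -/
abbrev scalarUnit (c : kˣ) : (QWA k n d q)ˣ := Units.map (algebraMap k (QWA k n d q)) c

theorem mul_hMon_of_semiconj {u : QWA k n d q} {v : Fin n → ℤ}
    (hu : ∀ i, u * (h i : (QWA k n d q)ˣ) = ((q i ^ v i : kˣ) : k) • ((h i : (QWA k n d q)ˣ) * u))
    (s : Fin n → ℤ) : u * hMon s = (MvLaurent.chi q v s : k) • (hMon s * u) := by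
  have key : ∀ i m, u * hMon (Pi.single i m) =
      (MvLaurent.chi q v (Pi.single i m) : k) • (hMon (Pi.single i m) * u) := by
    intro i m
    rw [hMon_single, MvLaurent.chi_single_right]
    have h1 : SemiconjBy u (h i : (QWA k n d q)ˣ)
        ((scalarUnit (q i ^ v i) * h i : (QWA k n d q)ˣ) : QWA k n d q) := by
      rw [SemiconjBy, hu, Algebra.smul_def, Units.val_mul, mul_assoc]
      rfl
    have h2 := SemiconjBy.units_zpow_right h1 m
    rw [SemiconjBy, Commute.mul_zpow (Units.ext (Algebra.commutes _ _)), ← map_zpow, ← zpow_mul] at h2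
    rw [h2, Algebra.smul_def, Units.val_mul, mul_assoc]
    rfl
  rw [← Finset.univ_sum_single s]
  induction (Finset.univ : Finset (Fin n)) using Finset.cons_induction with
  | empty => simp [hMon_zero, MvLaurent.chi_zero_right]
  | cons i A hi ih =>
    rw [Finset.sum_cons, hMon_add, MvLaurent.chi_add_right, ← mul_assoc, key, smul_mul_assoc,
      mul_assoc, ih, mul_smul_comm, smul_smul, mul_assoc, Units.val_mul]

theorem mul_evalAll_of_semiconj {u : QWA k n d q} {v : Fin n → ℤ}
    (hu : ∀ i, u * (h i : (QWA k n d q)ˣ) = ((q i ^ v i : kˣ) : k) • ((h i : (QWA k n d q)ˣ) * u))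
    (f : MvLaurent k n) : u * evalAll f = evalAll (MvLaurent.twist q v f) * u := by
  induction f using AddMonoidAlgebra.induction_linear with
  | zero => simp
  | add p p' hp hp' => simp only [map_add, mul_add, add_mul, hp, hp']
  | single s a =>
    rw [MvLaurent.twist_single, evalAll_single, evalAll_single, mul_smul_comm,
      mul_hMon_of_semiconj hu, smul_smul, smul_mul_assoc]

theorem x_mul_evalAll (j : Fin n) (f : MvLaurent k n) :
    (x j : QWA k n d q) * evalAll f = evalAll (MvLaurent.twist q (Pi.single j 1) f) * x j := by
  refine mul_evalAll_of_semiconj (fun i ↦ ?_) f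
  rcases eq_or_ne i j with rfl | hij
  · simpa using isFamily_gens.xh i
  · simpa [hij] using (isFamily_gens.comm_hx i j hij).symm

theorem y_mul_evalAll (j : Fin n) (f : MvLaurent k n) :
    (y j : QWA k n d q) * evalAll f = evalAll (MvLaurent.twist q (Pi.single j (-1)) f) * y j := by
  refine mul_evalAll_of_semiconj (fun i ↦ ?_) f
  rcases eq_or_ne i j with rfl | hij
  · simpa using isFamily_gens.yh i
  · simpa [hij] using (isFamily_gens.comm_hy i j hij).symm

end Relations

end QWA

namespace MvLaurent

open AddMonoidAlgebra

variable {k : Type*} [Field k] {n : ℕ}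

/-- The variable `h_j`. -/
def var (j : Fin n) : MvLaurent k n := single (Pi.single j 1) 1

theorem var_pow (j : Fin n) (d : ℕ) : (var j : MvLaurent k n) ^ d = single (Pi.single j (d : ℤ)) 1 := by
  rw [var, AddMonoidAlgebra.single_pow, one_pow, ← Pi.single_smul, nsmul_eq_mul, mul_one]

theorem twist_var (q : Fin n → kˣ) (v) (j : Fin n) :
    twist q v (var j) = ((q j ^ v j : kˣ) : k) • var j := by
  rw [var, twist_single, chi_single_right, smul_single, mul_one, one_mul, smul_eq_mul, mul_one]

theorem spec_var (j : Fin n) (c : kˣ) : spec j c (var j) = (c : k) • (1 : MvLaurent k n) := by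
  rw [var, spec_single, forget_single, one_def, smul_single]
  simp

theorem var_mul_inv (j : Fin n) :
    (var j : MvLaurent k n) * single (-Pi.single j 1) 1 = 1 := by
  rw [var, single_mul_single, add_neg_cancel, mul_one, one_def]

theorem algHom_ext_var {A : Type*} [Semiring A] [Algebra k A] {f g : MvLaurent k n →ₐ[k] A}
    (h : ∀ j, f (var j) = g (var j)) : f = g := by
  let S : AddSubgroup (Fin n → ℤ) :=
    { carrier := {s | f (single s 1) = g (single s 1)}
      zero_mem' := by
        change f (single 0 1) = g (single 0 1)
        rw [← one_def, map_one, map_one]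
      add_mem' := by
        intro s t hs ht
        change f (single (s + t) 1) = g (single (s + t) 1)
        have e : (single (s + t) 1 : MvLaurent k n) = single s 1 * single t 1 := by
          rw [single_mul_single, mul_one]
        rw [e, map_mul, map_mul, hs, ht]
      neg_mem' := by
        intro s hs
        change f (single (-s) 1) = g (single (-s) 1)
        refine left_inv_eq_right_inv (a := f (single s 1)) ?_ ?_
        · rw [← map_mul, single_mul_single, neg_add_cancel, mul_one, ← one_def, map_one]
        · rw [show f (single s 1) = g (single s 1) from hs, ← map_mul, single_mul_single,
            add_neg_cancel, mul_one, ← one_def, map_one] }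
  refine algHom_ext_single fun s ↦ ?_
  change s ∈ S
  rw [← Finset.univ_sum_single s]
  refine S.sum_mem fun j _ ↦ ?_
  have : Pi.single j (s j) = s j • (Pi.single j 1 : Fin n → ℤ) := by
    rw [← Pi.single_smul, smul_eq_mul, mul_one]
  rw [this]
  exact S.zsmul_mem (h j) _

theorem twist_incl_of_eq_zero (q : Fin n → kˣ) {v : Fin n → ℤ} {j : Fin n} (hv : v j = 0)
    (p : k[T;T⁻¹]) : twist q v (incl j p) = incl j p := by
  induction p using AddMonoidAlgebra.induction_linear with
  | zero => simp
  | add p p' hp hp' => simp only [map_add, hp, hp']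
  | single m a => rw [incl_single, twist_single, chi_single_right, hv]; simp

end MvLaurent

open MvLaurent

variable {k : Type*} [Field k] {n d : ℕ} {q : Fin n → kˣ}

/-- The group `ℤⁿ`, written multiplicatively, that acts on the Laurent polynomials by `twist q`. -/
def Torus (_ : Fin n → kˣ) : Type := Multiplicative (Fin n → ℤ)

namespace Torus

instance : CommGroup (Torus q) := inferInstanceAs (CommGroup (Multiplicative (Fin n → ℤ)))

instance : TwoUniqueProds (Torus q) :=
  inferInstanceAs (TwoUniqueProds (Multiplicative (Fin n → ℤ)))

/-- An exponent vector as an element of the group. -/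
def of (q : Fin n → kˣ) (v : Fin n → ℤ) : Torus q := Multiplicative.ofAdd v

theorem of_add (v w : Fin n → ℤ) : of q (v + w) = of q v * of q w := rfl

theorem of_injective : Function.Injective (of q) := Multiplicative.ofAdd.injective

theorem of_surjective : Function.Surjective (of q) := Multiplicative.ofAdd.surjective

instance : MulSemiringAction (Torus q) (MvLaurent k n) where
  smul g f := twist q (Multiplicative.toAdd g) f
  one_smul f := congrArg (fun F : MvLaurent k n →ₐ[k] MvLaurent k n ↦ F f) (twist_zero q)
  mul_smul _ _ f := twist_add q _ _ f
  smul_zero _ := map_zero (twist q _)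
  smul_add _ := map_add (twist q _)
  smul_one _ := map_one (twist q _)
  smul_mul _ := map_mul (twist q _)

instance : SMulCommClass (Torus q) k (MvLaurent k n) where
  smul_comm _ c f := map_smul (twist q _) c f

end Torus

/-- The quantum torus: the skew Laurent polynomials in `x_1, …, x_n` over the Laurent polynomials in
`h_1, …, h_n`. -/
abbrev QTorus (q : Fin n → kˣ) : Type _ := SkewMonoidAlgebra (MvLaurent k n) (Torus q)

namespace QTorus

/-- The element `f x ^ v`. -/
def mono (q : Fin n → kˣ) (v : Fin n → ℤ) (f : MvLaurent k n) : QTorus q :=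
  SkewMonoidAlgebra.single (Torus.of q v) f

theorem mono_mul_mono (v w : Fin n → ℤ) (f g : MvLaurent k n) :
    mono q v f * mono q w g = mono q (v + w) (f * twist q v g) :=
  SkewMonoidAlgebra.single_mul_single

theorem smul_mono (c : k) (v : Fin n → ℤ) (f : MvLaurent k n) :
    c • mono q v f = mono q v (c • f) :=
  SkewMonoidAlgebra.smul_single _ _ _

theorem mono_injective (v : Fin n → ℤ) : Function.Injective (mono q v) :=
  SkewMonoidAlgebra.single_injective _

theorem coeff_mono (v w : Fin n → ℤ) (f : MvLaurent k n) :
    (mono q v f).coeff (Torus.of q w) = Finsupp.single v f w := by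
  classical
  rw [mono, SkewMonoidAlgebra.coeff_single_apply, Finsupp.single_apply]
  simp only [Torus.of_injective.eq_iff]

/-- The inclusion of the Laurent polynomials in `h_1, …, h_n`. -/
def monoZero (q : Fin n → kˣ) : MvLaurent k n →ₐ[k] QTorus q where
  __ := SkewMonoidAlgebra.singleOneRingHom
  commutes' _ := rfl

/-- The images of the units `h_j`. -/
def unitH (q : Fin n → kˣ) (j : Fin n) : (QTorus q)ˣ :=
  Units.map (monoZero q : MvLaurent k n →* QTorus q)
    ⟨var j, .single (-Pi.single j 1) 1, var_mul_inv j, by rw [mul_comm, var_mul_inv]⟩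

theorem unitH_val (j : Fin n) : (unitH q j : QTorus q) = mono q 0 (var j) := rfl

theorem aD_mono_zero (d : ℕ) (f : MvLaurent k n) : aD d (mono q 0 f) = mono q 0 (aD d f) :=
  (map_aD (monoZero q) d f).symm

theorem isFamily (d : ℕ) (q : Fin n → kˣ) :
    QWA.IsFamily n d q (fun j ↦ mono q (Pi.single j 1) 1)
      (fun j ↦ mono q (Pi.single j (-1)) (aD d (var j))) (unitH q) where
  xh i := by
    simp only [unitH_val, mono_mul_mono, smul_mono, twist_var, add_zero, zero_add, one_mul,
      Pi.single_eq_same, zpow_one, twist_zero, map_one, mul_one]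
  yh i := by
    simp only [unitH_val, mono_mul_mono, smul_mono, twist_var, add_zero, zero_add,
      Pi.single_eq_same, zpow_neg_one, twist_zero, AlgHom.id_apply, mul_smul_comm,
      Units.val_inv_eq_inv_val, mul_comm]
  xy i := by
    simp only [unitH_val, mono_mul_mono, smul_mono, aD_mono_zero, map_aD, twist_var,
      Pi.single_eq_same, zpow_one, ← Pi.single_add, add_neg_cancel, Pi.single_zero, one_mul]
  yx i := by
    simp only [unitH_val, mono_mul_mono, aD_mono_zero, map_one, mul_one,
      ← Pi.single_add, neg_add_cancel, Pi.single_zero]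
  comm_hh i j hij := by
    simp only [unitH_val, mono_mul_mono, twist_zero, AlgHom.id_apply, mul_comm]
  comm_hx i j hij := by
    simp only [unitH_val, mono_mul_mono, twist_zero, AlgHom.id_apply, twist_var,
      Pi.single_eq_of_ne hij, zpow_zero, Units.val_one, one_smul, add_zero, zero_add, mul_comm]
  comm_hy i j hij := by
    simp only [unitH_val, mono_mul_mono, twist_zero, AlgHom.id_apply, twist_var,
      Pi.single_eq_of_ne hij, zpow_zero, Units.val_one, one_smul, add_zero, zero_add, mul_comm]
  comm_xx i j hij := by
    simp only [mono_mul_mono, map_one, add_comm]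
  comm_xy i j hij := by
    simp only [mono_mul_mono, map_one, map_aD, twist_var, Pi.single_eq_of_ne hij.symm, zpow_zero,
      Units.val_one, one_smul, mul_one, one_mul, add_comm]
  comm_yy i j hij := by
    simp only [mono_mul_mono, map_aD, twist_var, Pi.single_eq_of_ne hij.symm,
      Pi.single_eq_of_ne hij, zpow_zero, Units.val_one, one_smul, add_comm, mul_comm]

end QTorus

namespace QWA

open MvLaurent QTorus

variable {k : Type*} [Field k] {n d : ℕ} {q : Fin n → kˣ}

/-- The homomorphism to the quantum torus. -/
def toTorus : QWA k n d q →ₐ[k] QTorus q := liftHom _ _ _ (QTorus.isFamily d q)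

theorem toTorus_x (j : Fin n) :
    toTorus (x j : QWA k n d q) = mono q (Pi.single j 1) 1 := liftHom_x _ _ _ _ j

theorem toTorus_y (j : Fin n) :
    toTorus (y j : QWA k n d q) = mono q (Pi.single j (-1)) (aD d (var j)) := liftHom_y _ _ _ _ j

theorem toTorus_evalAll (f : MvLaurent k n) :
    toTorus (evalAll f : QWA k n d q) = mono q 0 f := by
  have : (toTorus (d := d)).comp evalAll = monoZero q := algHom_ext_var fun j ↦ by
    rw [AlgHom.comp_apply, var, evalAll_h]
    exact liftHom_h _ _ _ _ j
  exact DFunLike.congr_fun this f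

/-- `x_j ^ m` for `m ≥ 0`, and `y_j ^ (-m)` for `m < 0`. -/
def xyPow (j : Fin n) : ℤ → QWA k n d q
  | .ofNat m => x j ^ m
  | .negSucc m => y j ^ (m + 1)

theorem xyPow_zero (j : Fin n) : (xyPow j 0 : QWA k n d q) = 1 := pow_zero _

theorem xyPow_one (j : Fin n) : (xyPow j 1 : QWA k n d q) = x j := pow_one _

theorem xyPow_neg_one (j : Fin n) : (xyPow j (-1) : QWA k n d q) = y j := pow_one _

theorem y_mul_xyPow (j : Fin n) {m : ℤ} (hm : m ≤ 0) :
    (y j * xyPow j m : QWA k n d q) = xyPow j (m - 1) := by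
  obtain ⟨a, rfl⟩ := Int.exists_eq_neg_ofNat hm
  cases a with
  | zero =>
    change y j * x j ^ 0 = y j ^ (0 + 1)
    simp
  | succ a =>
    have : (-((a + 1 : ℕ) : ℤ) - 1) = Int.negSucc (a + 1) := by omega
    rw [this]
    change y j * y j ^ (a + 1) = y j ^ (a + 1 + 1)
    rw [← pow_succ']

theorem evalAll_incl_aD (j : Fin n) (c : k) :
    (evalAll (incl j (aD d (LaurentPolynomial.C c * LaurentPolynomial.T 1))) : QWA k n d q) =
      aD d (c • ((h j : (QWA k n d q)ˣ) : QWA k n d q)) := by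
  rw [map_aD, map_aD, ← LaurentPolynomial.single_eq_C_mul_T, incl_single, ← evalAll_h, ← map_smul,
    AddMonoidAlgebra.smul_single, smul_eq_mul, mul_one]

theorem exists_x_mul_xyPow (j : Fin n) (m : ℤ) :
    ∃ p, (x j * xyPow j m : QWA k n d q) = evalAll (incl j p) * xyPow j (m + 1) := by
  rcases m with m | m
  · refine ⟨1, ?_⟩
    rw [map_one, map_one, one_mul]
    exact (pow_succ' _ _).symm
  · refine ⟨aD d (LaurentPolynomial.C (q j : k) * LaurentPolynomial.T 1), ?_⟩
    rw [evalAll_incl_aD, ← isFamily_gens.xy, mul_assoc]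
    congr 1
    rcases m with _ | m
    · rw [show Int.negSucc 0 + 1 = 0 from rfl, xyPow_zero, mul_one]
      exact pow_one (y j)
    · exact pow_succ' _ _

theorem exists_y_mul_xyPow (j : Fin n) (m : ℤ) :
    ∃ p, (y j * xyPow j m : QWA k n d q) = evalAll (incl j p) * xyPow j (m - 1) := by
  rcases le_or_gt m 0 with hm | hm
  · refine ⟨1, ?_⟩
    rw [map_one, map_one, one_mul, y_mul_xyPow j hm]
  · refine ⟨aD d (LaurentPolynomial.C (1 : k) * LaurentPolynomial.T 1), ?_⟩
    obtain ⟨a, rfl⟩ : ∃ a : ℕ, m = (a : ℤ) + 1 := ⟨(m - 1).toNat, by omega⟩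
    rw [evalAll_incl_aD, one_smul, ← isFamily_gens.yx, mul_assoc, add_sub_cancel_right]
    congr 1
    exact pow_succ' _ _

theorem commute_x_xyPow {i j : Fin n} (hij : i ≠ j) (m : ℤ) :
    Commute (x j : QWA k n d q) (xyPow i m) := by
  rcases m with m | m
  · exact Commute.pow_right (isFamily_gens.comm_xx j i hij.symm) _
  · exact Commute.pow_right (isFamily_gens.comm_xy j i hij.symm) _

theorem commute_y_xyPow {i j : Fin n} (hij : i ≠ j) (m : ℤ) :
    Commute (y j : QWA k n d q) (xyPow i m) := by
  rcases m with m | m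
  · exact Commute.pow_right (isFamily_gens.comm_xy i j hij).symm _
  · exact Commute.pow_right (isFamily_gens.comm_yy j i hij.symm) _

theorem commute_evalAll_incl_xyPow {i j : Fin n} (hij : i ≠ j) (p : k[T;T⁻¹]) (m : ℤ) :
    Commute (evalAll (incl j p) : QWA k n d q) (xyPow i m) := by
  rcases m with m | m
  · refine Commute.pow_right ?_ _
    rw [Commute, SemiconjBy, x_mul_evalAll, twist_incl_of_eq_zero _ (Pi.single_eq_of_ne hij.symm _)]
  · refine Commute.pow_right ?_ _
    rw [Commute, SemiconjBy, y_mul_evalAll, twist_incl_of_eq_zero _ (Pi.single_eq_of_ne hij.symm _)]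

/-- The product of the `xyPow j (v j)`, a basis of `A(n, d, q)` over the Laurent polynomials. -/
def xyMon (v : Fin n → ℤ) : QWA k n d q := (List.ofFn fun j ↦ xyPow j (v j)).prod

theorem xyMon_zero : (xyMon 0 : QWA k n d q) = 1 := by
  simp [xyMon, xyPow_zero]

theorem xyMon_single (j : Fin n) (m : ℤ) : (xyMon (Pi.single j m) : QWA k n d q) = xyPow j m := by
  rw [xyMon, ← List.prod_ofFn_update_one j (xyPow j m : QWA k n d q)]
  congr 2
  ext i : 1
  by_cases hi : i = j
  · subst hi; simp
  · simp [hi, xyPow_zero]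

theorem mul_xyMon (j : Fin n) {a : QWA k n d q} (ha : ∀ i, i ≠ j → ∀ m, Commute a (xyPow i m))
    {p : k[T;T⁻¹]} {v : Fin n → ℤ} {e : ℤ}
    (h : a * xyPow j (v j) = evalAll (incl j p) * xyPow j (v j + e)) :
    a * xyMon v = evalAll (incl j p) * xyMon (v + Pi.single j e) := by
  rw [xyMon, xyMon, List.mul_prod_ofFn _ j _ fun i hi ↦ ha i hi _,
    List.mul_prod_ofFn _ j _ fun i hi ↦ commute_evalAll_incl_xyPow hi p _, h]
  congr 2
  ext i : 1
  by_cases hi : i = j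
  · subst hi; simp
  · simp [hi]

theorem exists_x_mul_xyMon (j : Fin n) (v : Fin n → ℤ) :
    ∃ f, (x j * xyMon v : QWA k n d q) = evalAll f * xyMon (v + Pi.single j 1) := by
  obtain ⟨p, hp⟩ := exists_x_mul_xyPow (d := d) (q := q) j (v j)
  exact ⟨_, mul_xyMon j (fun i hi m ↦ commute_x_xyPow hi m) hp⟩

theorem exists_y_mul_xyMon (j : Fin n) (v : Fin n → ℤ) :
    ∃ f, (y j * xyMon v : QWA k n d q) = evalAll f * xyMon (v + Pi.single j (-1)) := by
  obtain ⟨p, hp⟩ := exists_y_mul_xyPow (d := d) (q := q) j (v j)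
  exact ⟨_, mul_xyMon j (fun i hi m ↦ commute_y_xyPow hi m) hp⟩

theorem xyMon_eq_y_mul {j : Fin n} {v : Fin n → ℤ} (hv : v j < 0) :
    (xyMon v : QWA k n d q) = y j * xyMon (v + Pi.single j 1) := by
  rw [mul_xyMon (p := 1) (e := -1) j (fun i hi m ↦ commute_y_xyPow hi m)
    (by rw [map_one, map_one, one_mul, y_mul_xyPow]; · rfl
        · simp only [Pi.add_apply, Pi.single_eq_same]; omega),
    map_one, map_one, one_mul, add_assoc, ← Pi.single_add, add_neg_cancel, Pi.single_zero, add_zero]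

section ToTorus

/-- The elements `f x ^ v` with `f ≠ 0`. -/
def IsMono (v : Fin n → ℤ) (t : QTorus q) : Prop := ∃ f, f ≠ 0 ∧ t = mono q v f

theorem IsMono.mul {v w : Fin n → ℤ} {t u : QTorus q} (ht : IsMono v t) (hu : IsMono w u) :
    IsMono (v + w) (t * u) := by
  obtain ⟨f, hf, rfl⟩ := ht
  obtain ⟨g, hg, rfl⟩ := hu
  exact ⟨_, mul_ne_zero hf ((map_ne_zero_iff _ (twist_injective q v)).2 hg), mono_mul_mono _ _ _ _⟩

theorem isMono_one : IsMono 0 (1 : QTorus q) := ⟨1, one_ne_zero, rfl⟩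

theorem IsMono.pow {v : Fin n → ℤ} {t : QTorus q} (ht : IsMono v t) (m : ℕ) :
    IsMono (m • v) (t ^ m) := by
  induction m with
  | zero => simpa using isMono_one
  | succ m ih => rw [succ_nsmul, pow_succ]; exact ih.mul ht

theorem IsMono.list_prod {l : ℕ} {v : Fin l → Fin n → ℤ} {t : Fin l → QTorus q}
    (ht : ∀ i, IsMono (v i) (t i)) : IsMono (∑ i, v i) (List.ofFn t).prod := by
  induction l with
  | zero => simpa using isMono_one
  | succ l ih =>
    rw [Fin.sum_univ_succ, List.ofFn_succ, List.prod_cons]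
    exact (ht 0).mul (ih fun i ↦ ht i.succ)

theorem aD_var_ne_zero (hd : 0 < d) (j : Fin n) : aD d (var j : MvLaurent k n) ≠ 0 := by
  rw [aD, var_pow, sub_ne_zero, AddMonoidAlgebra.one_def]
  intro h
  have h1 := congrArg (fun F ↦ AddMonoidAlgebra.coeff F 0) h
  have h2 : (Pi.single j (d : ℤ) : Fin n → ℤ) ≠ 0 := by simp; omega
  simp only [AddMonoidAlgebra.coeff_single, Finsupp.single_eq_same,
    Finsupp.single_apply, if_neg h2] at h1
  exact zero_ne_one h1

theorem isMono_toTorus_xyPow (hd : 0 < d) (j : Fin n) (m : ℤ) :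
    IsMono (Pi.single j m) (toTorus (xyPow j m : QWA k n d q)) := by
  rcases m with m | m
  · have := IsMono.pow (q := q) ⟨1, one_ne_zero, toTorus_x (d := d) j⟩ m
    rw [← map_pow, ← Pi.single_smul, nsmul_eq_mul, mul_one] at this
    exact this
  · have := IsMono.pow (q := q) ⟨_, aD_var_ne_zero hd j, toTorus_y (d := d) j⟩ (m + 1)
    rw [← map_pow, ← Pi.single_smul, nsmul_eq_mul, mul_neg_one] at this
    exact this

theorem isMono_toTorus_xyMon (hd : 0 < d) (v : Fin n → ℤ) :
    IsMono v (toTorus (xyMon v : QWA k n d q)) := by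
  rw [xyMon, map_list_prod, List.map_ofFn]
  have := IsMono.list_prod (v := fun j ↦ Pi.single j (v j)) fun j ↦
    isMono_toTorus_xyPow (q := q) hd j (v j)
  rwa [Finset.univ_sum_single] at this

/-- Linear combinations of the `xyMon v` with Laurent polynomials as coefficients. -/
def combination : ((Fin n → ℤ) →₀ MvLaurent k n) →+ QWA k n d q :=
  Finsupp.liftAddHom fun v ↦ (AddMonoidHom.mulRight (xyMon v)).comp
    (evalAll : MvLaurent k n →ₐ[k] QWA k n d q).toRingHom.toAddMonoidHom

theorem combination_single (v : Fin n → ℤ) (f : MvLaurent k n) :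
    (combination (.single v f) : QWA k n d q) = evalAll f * xyMon v := by
  simp [combination]

theorem exists_mul_combination {a : QWA k n d q} (h : ∀ v f, ∃ G, a * (evalAll f * xyMon v) = combination G)
    (F : (Fin n → ℤ) →₀ MvLaurent k n) : ∃ G, a * combination F = combination G := by
  induction F using Finsupp.induction_linear with
  | zero => exact ⟨0, by simp⟩
  | add F F' hF hF' =>
    obtain ⟨G, hG⟩ := hF
    obtain ⟨G', hG'⟩ := hF'
    exact ⟨G + G', by rw [map_add, map_add, mul_add, hG, hG']⟩
  | single v f => rw [combination_single]; exact h v f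

theorem combination_surjective : Function.Surjective (combination (k := k) (d := d) (q := q)) := by
  have key : ∀ (a : FreeAlgebra k (Gen n)) F, ∃ G, mk a * combination F =
      (combination G : QWA k n d q) := by
    intro a
    induction a using FreeAlgebra.induction with
    | grade0 c =>
      refine exists_mul_combination fun v f ↦ ⟨.single v (c • f), ?_⟩
      rw [AlgHom.commutes, combination_single, map_smul, smul_mul_assoc, Algebra.smul_def]
    | grade1 g =>
      refine exists_mul_combination fun v f ↦ ?_
      cases g with
      | x j =>
        obtain ⟨g, hg⟩ := exists_x_mul_xyMon (d := d) (q := q) j v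
        refine ⟨.single (v + Pi.single j 1) (twist q (Pi.single j 1) f * g), ?_⟩
        change x j * _ = _
        rw [← mul_assoc, x_mul_evalAll, mul_assoc, hg, combination_single, map_mul, mul_assoc]
      | y j =>
        obtain ⟨g, hg⟩ := exists_y_mul_xyMon (d := d) (q := q) j v
        refine ⟨.single (v + Pi.single j (-1)) (twist q (Pi.single j (-1)) f * g), ?_⟩
        change y j * _ = _
        rw [← mul_assoc, y_mul_evalAll, mul_assoc, hg, combination_single, map_mul, mul_assoc]
      | h j =>
        refine ⟨.single v (.single (Pi.single j 1) 1 * f), ?_⟩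
        change ((h j : (QWA k n d q)ˣ) : QWA k n d q) * _ = _
        rw [combination_single, map_mul, evalAll_h, mul_assoc]
      | hinv j =>
        refine ⟨.single v (.single (Pi.single j (-1)) 1 * f), ?_⟩
        change (((h j)⁻¹ : (QWA k n d q)ˣ) : QWA k n d q) * _ = _
        rw [combination_single, map_mul, evalAll_single, hMon_single, one_smul, zpow_neg_one,
          mul_assoc]
    | mul a b ha hb =>
      intro F
      obtain ⟨G, hG⟩ := hb F
      obtain ⟨G', hG'⟩ := ha G
      exact ⟨G', by rw [map_mul, mul_assoc, hG, hG']⟩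
    | add a b ha hb =>
      intro F
      obtain ⟨G, hG⟩ := ha F
      obtain ⟨G', hG'⟩ := hb F
      exact ⟨G + G', by rw [map_add, add_mul, hG, hG', map_add]⟩
  intro a
  obtain ⟨a, rfl⟩ := mk_surjective a
  obtain ⟨G, hG⟩ := key a (.single 0 1)
  rw [combination_single, map_one, xyMon_zero, mul_one, mul_one] at hG
  exact ⟨G, hG.symm⟩

theorem coeff_toTorus_combination {w : Fin n → ℤ} {g : MvLaurent k n}
    (hg : toTorus (xyMon w : QWA k n d q) = mono q w g) (hd : 0 < d)
    (F : (Fin n → ℤ) →₀ MvLaurent k n) :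
    (toTorus (combination F : QWA k n d q)).coeff (Torus.of q w) = F w * g := by
  induction F using Finsupp.induction_linear with
  | zero => simp
  | add F F' hF hF' => simp [hF, hF', add_mul]
  | single v f =>
    rw [combination_single, map_mul, toTorus_evalAll]
    by_cases hv : v = w
    · subst hv
      rw [hg, mono_mul_mono, zero_add, coeff_mono, twist_zero, Finsupp.single_eq_same,
        Finsupp.single_eq_same]
      rfl
    · obtain ⟨f', -, hf'⟩ := isMono_toTorus_xyMon (q := q) hd v
      rw [hf', mono_mul_mono, zero_add, coeff_mono, Finsupp.single_eq_of_ne (Ne.symm hv),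
        Finsupp.single_eq_of_ne (Ne.symm hv), zero_mul]

theorem exists_evalAll_mul_xyMon (hd : 0 < d) {a : QWA k n d q} {v : Fin n → ℤ} {f : MvLaurent k n}
    (ha : toTorus a = mono q v f) : ∃ g, a = evalAll g * xyMon v := by
  obtain ⟨F, rfl⟩ := combination_surjective a
  have : F = .single v (F v) := by
    ext1 w
    by_cases hw : v = w
    · subst hw; simp
    · obtain ⟨g, hg0, hg⟩ := isMono_toTorus_xyMon (q := q) hd w
      have h1 := coeff_toTorus_combination hg hd F
      rw [ha, coeff_mono, Finsupp.single_eq_of_ne (Ne.symm hw)] at h1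
      rw [Finsupp.single_eq_of_ne (Ne.symm hw)]
      exact (mul_eq_zero.1 h1.symm).resolve_right hg0
  exact ⟨F v, by rw [this, combination_single]; simp⟩

theorem toTorus_injective (hd : 0 < d) : Function.Injective (toTorus (k := k) (d := d) (q := q)) := by
  rw [injective_iff_map_eq_zero]
  intro a ha
  obtain ⟨F, rfl⟩ := combination_surjective a
  have : F = 0 := by
    ext1 w
    obtain ⟨g, hg0, hg⟩ := isMono_toTorus_xyMon (q := q) hd w
    have h1 := coeff_toTorus_combination hg hd F
    rw [ha] at h1
    exact (mul_eq_zero.1 h1.symm).resolve_right hg0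
  rw [this, map_zero]

theorem evalAll_injective : Function.Injective (evalAll : MvLaurent k n →ₐ[k] QWA k n d q) := by
  intro f g h
  have := congrArg toTorus h
  rw [toTorus_evalAll, toTorus_evalAll] at this
  exact mono_injective _ this

theorem evalAll_mul_right_cancel {u : QWA k n d q} {v : Fin n → ℤ} (hu : IsMono v (toTorus u))
    {f g : MvLaurent k n} (h : evalAll f * u = evalAll g * u) : f = g := by
  obtain ⟨e, he, hu⟩ := hu
  have := congrArg toTorus h
  rw [map_mul, map_mul, hu, toTorus_evalAll, toTorus_evalAll, mono_mul_mono, mono_mul_mono,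
    twist_zero] at this
  exact mul_right_cancel₀ he (mono_injective _ this)

theorem spec_aD_var (j : Fin n) {c : kˣ} (hc : c ^ d = 1) :
    spec j c (aD d (var j : MvLaurent k n)) = 0 := by
  rw [map_aD, spec_var, aD, smul_pow, one_pow, ← Units.val_pow_eq_pow_val, hc, Units.val_one,
    one_smul, sub_self]

theorem toTorus_xyMon_eq {j : Fin n} {v : Fin n → ℤ} (hv : v j < 0) {g : MvLaurent k n}
    (hg : toTorus (xyMon (v + Pi.single j 1) : QWA k n d q) = mono q (v + Pi.single j 1) g) :
    toTorus (xyMon v : QWA k n d q) =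
      mono q v (aD d (var j) * twist q (Pi.single j (-1)) g) := by
  rw [xyMon_eq_y_mul hv, map_mul, hg, toTorus_y, mono_mul_mono, add_left_comm, ← Pi.single_add,
    neg_add_cancel, Pi.single_zero, add_zero]

/-- A homogeneous component of degree `v` with `v_j < 0` vanishes at `h_j = 1`. -/
theorem spec_one_eq_zero (hd : 0 < d) {a : QWA k n d q} {v : Fin n → ℤ} {f : MvLaurent k n}
    (ha : toTorus a = mono q v f) {j : Fin n} (hv : v j < 0) : spec j 1 f = 0 := by
  obtain ⟨g, rfl⟩ := exists_evalAll_mul_xyMon hd ha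
  obtain ⟨g', -, hg'⟩ := isMono_toTorus_xyMon (q := q) hd (v + Pi.single j 1)
  rw [map_mul, toTorus_evalAll, toTorus_xyMon_eq hv hg', mono_mul_mono, zero_add] at ha
  rw [← mono_injective _ ha, twist_zero, AlgHom.id_apply, map_mul, map_mul,
    spec_aD_var j (one_pow d), zero_mul, mul_zero]

/-- A homogeneous component of degree `v` with `v_j < -1` vanishes at `h_j = q_j`. -/
theorem spec_q_eq_zero (hd : 0 < d) {a : QWA k n d q} {v : Fin n → ℤ} {f : MvLaurent k n}
    (ha : toTorus a = mono q v f) {j : Fin n} (hv : v j < -1) : spec j (q j) f = 0 := by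
  obtain ⟨g, rfl⟩ := exists_evalAll_mul_xyMon hd ha
  obtain ⟨g', -, hg'⟩ := isMono_toTorus_xyMon (q := q) hd (v + Pi.single j 1 + Pi.single j 1)
  have hv' : (v + Pi.single j 1 : Fin n → ℤ) j < 0 := by simp only [Pi.add_apply, Pi.single_eq_same]; omega
  have h1 := toTorus_xyMon_eq (by omega) (toTorus_xyMon_eq hv' hg')
  rw [map_mul, toTorus_evalAll, h1, mono_mul_mono, zero_add] at ha
  have h2 : spec j (q j) (twist q (Pi.single j (-1)) (aD d (var j : MvLaurent k n))) = 0 := by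
    rw [map_aD, map_aD, twist_var, map_smul, spec_var, smul_smul, ← Units.val_mul, Pi.single_eq_same,
      zpow_neg_one, inv_mul_cancel, Units.val_one, one_smul, aD, one_pow, sub_self]
  rw [← mono_injective _ ha, twist_zero, AlgHom.id_apply, map_mul, map_mul, map_mul, map_mul, h2]
  simp

end ToTorus

end QWA

namespace QWA

open MvLaurent QTorus

variable {k : Type*} [Field k] {n d : ℕ} {q : Fin n → kˣ}

/-- The degree of `x ^ (1 - τ) y ^ τ`. -/
def sgn (τ : Fin 2) : ℤ := (-1) ^ (τ : ℕ)

theorem sgn_zero : sgn 0 = 1 := rfl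

theorem sgn_one : sgn 1 = -1 := rfl

theorem zpow_compat_iff {G : Type*} [CommGroup G] (a b : G) (s t : ℤ) (τ τ' : Fin 2) :
    a ^ (s * (1 - ((τ : ℕ) : ℤ))) * a ^ (-s * ((τ : ℕ) : ℤ)) * b ^ (-t * (1 - ((τ' : ℕ) : ℤ))) *
      b ^ (t * ((τ' : ℕ) : ℤ)) = 1 ↔ a ^ (sgn τ * s) = b ^ (sgn τ' * t) := by
  rw [← zpow_add, mul_assoc, ← zpow_add, mul_eq_one_iff_eq_inv, ← zpow_neg]
  fin_cases τ <;> fin_cases τ' <;> simp [sgn]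

theorem x_pow_mul_y_pow (j : Fin n) (τ : Fin 2) :
    (x j ^ (1 - (τ : ℕ)) * y j ^ (τ : ℕ) : QWA k n d q) = xyPow j (sgn τ) := by
  fin_cases τ
  · simp [sgn_zero, xyPow_one]
  · simp [sgn_one, xyPow_neg_one]

theorem x_pow_mul_y_pow' (j : Fin n) (τ : Fin 2) :
    (x j ^ (τ : ℕ) * y j ^ (1 - (τ : ℕ)) : QWA k n d q) = xyPow j (-sgn τ) := by
  fin_cases τ
  · simp [sgn_zero, xyPow_neg_one]
  · simp [sgn_one, xyPow_one]

/-- The elements that commute with the Laurent polynomials up to `twist q v`. -/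
def IsWeight (v : Fin n → ℤ) (u : QWA k n d q) : Prop :=
  ∀ f, u * evalAll f = evalAll (twist q v f) * u

theorem isWeight_xyPow_sgn (j : Fin n) (τ : Fin 2) :
    IsWeight (Pi.single j (sgn τ)) (xyPow j (sgn τ) : QWA k n d q) := by
  fin_cases τ
  · exact fun f ↦ by simpa [sgn_zero, xyPow_one] using x_mul_evalAll j f
  · exact fun f ↦ by simpa [sgn_one, xyPow_neg_one] using y_mul_evalAll j f

theorem isWeight_xyPow_neg_sgn (j : Fin n) (τ : Fin 2) :
    IsWeight (Pi.single j (-sgn τ)) (xyPow j (-sgn τ) : QWA k n d q) := by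
  fin_cases τ
  · exact isWeight_xyPow_sgn j 1
  · exact isWeight_xyPow_sgn j 0

theorem commute_xyPow_xyPow {i j : Fin n} (hij : i ≠ j) (m m' : ℤ) :
    Commute (xyPow i m : QWA k n d q) (xyPow j m') := by
  rcases m with m | m
  · exact (commute_x_xyPow hij.symm m').pow_left _
  · exact (commute_y_xyPow hij.symm m').pow_left _

/-- The Laurent polynomial `a_d(c ^ (1 - τ) T)`. -/
abbrev sideFactor (d : ℕ) (c : kˣ) (τ : Fin 2) : k[T;T⁻¹] :=
  aD d (LaurentPolynomial.C ((c : k) ^ (1 - (τ : ℕ))) * LaurentPolynomial.T 1)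

theorem incl_aD (j : Fin n) (d : ℕ) (c : k) (m : ℤ) :
    incl j (aD d (LaurentPolynomial.C c * LaurentPolynomial.T m)) =
      aD d (.single (Pi.single j m) c : MvLaurent k n) := by
  rw [map_aD, ← LaurentPolynomial.single_eq_C_mul_T, incl_single]

theorem xyPow_sgn_mul_neg_sgn (j : Fin n) (τ : Fin 2) :
    (xyPow j (sgn τ) * xyPow j (-sgn τ) : QWA k n d q) =
      evalAll (incl j (sideFactor d (q j) τ)) := by
  rw [evalAll_incl_aD]
  fin_cases τ
  · simpa [sgn_zero, xyPow_one, xyPow_neg_one] using isFamily_gens.xy j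
  · simpa [sgn_one, xyPow_one, xyPow_neg_one] using isFamily_gens.yx j

theorem twist_single_single (j : Fin n) (v : Fin n → ℤ) (m : ℤ) (a : k) :
    twist q v (.single (Pi.single j m) a) =
      ((q j ^ (v j * m) : kˣ) : k) • (.single (Pi.single j m) a : MvLaurent k n) := by
  rw [twist_single, chi_single_right, AddMonoidAlgebra.smul_single, smul_eq_mul, mul_comm]

theorem xyPow_neg_sgn_mul_sgn (j : Fin n) (τ : Fin 2) :
    (xyPow j (-sgn τ) * xyPow j (sgn τ) : QWA k n d q) =
      evalAll (twist q (Pi.single j (-sgn τ)) (incl j (sideFactor d (q j) τ))) := by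
  rw [incl_aD, map_aD, twist_single_single, map_aD, map_smul]
  fin_cases τ
  · simpa [sgn_zero, xyPow_one, xyPow_neg_one, evalAll_single, hMon_single, smul_smul]
      using isFamily_gens.yx j
  · simpa [sgn_one, xyPow_one, xyPow_neg_one, evalAll_single, hMon_single]
      using isFamily_gens.xy j

theorem commute_evalAll_mul {v v' : Fin n → ℤ} {u u' : QWA k n d q} {f f' : MvLaurent k n}
    (hu : IsWeight v u) (hu' : IsWeight v' u') (huu : Commute u u') {c : k}
    (hf : twist q v f' = c • f') (hf' : twist q v' f = c • f) :
    (evalAll f * u) * (evalAll f' * u') = (evalAll f' * u') * (evalAll f * u) := by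
  have e : ∀ g g' (t t' : QWA k n d q), evalAll g * (evalAll g' * t * t') =
      evalAll (g * g') * (t * t') := fun g g' t t' ↦ by simp only [map_mul, mul_assoc]
  rw [mul_assoc, mul_assoc, ← mul_assoc u, ← mul_assoc u', hu, hu', hf, hf', e, e, huu.eq,
    mul_smul_comm, mul_smul_comm, mul_comm f]

theorem twist_smul_incl_mul_single {j : Fin n} {v : Fin n → ℤ} (hv : v j = 0) (c : k)
    (p : k[T;T⁻¹]) (s : Fin n → ℤ) :
    twist q v (c • (incl j p * .single s 1)) =
      (chi q v s : k) • (c • (incl j p * .single s 1)) := by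
  have e : (chi q v s : k) • (.single s 1 : MvLaurent k n) = .single s (1 * chi q v s : k) := by
    rw [AddMonoidAlgebra.smul_single, one_mul, smul_eq_mul, mul_one]
  rw [map_smul, map_mul, twist_incl_of_eq_zero _ hv, twist_single, ← e, mul_smul_comm, smul_comm]

theorem twist_comm (v w : Fin n → ℤ) (f : MvLaurent k n) :
    twist q v (twist q w f) = twist q w (twist q v f) := by
  rw [← twist_add, ← twist_add, add_comm]

namespace HomDatum

variable {r : ℕ} (D : HomDatum k r n)

/-- The Laurent polynomial `b_i p_i(h_{w(i)}) h ^ (t_i)`. -/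
def coefX (i : Fin r) : MvLaurent k n :=
  (D.b i : k) • (incl (D.w i) (D.p i) * .single (D.t i) 1)

/-- The Laurent polynomial `b_i⁻¹ p'_i(h_{w(i)}) h ^ (-t_i)`. -/
def coefY (i : Fin r) : MvLaurent k n :=
  ((D.b i)⁻¹ : k) • (incl (D.w i) (D.p' i) * .single (fun j ↦ -D.t i j) 1)

/-- The degree of the image of `x_i`. -/
def deg (i : Fin r) : Fin n → ℤ := Pi.single (D.w i) (sgn (D.τ i))

/-- The image of `h_i` as a Laurent polynomial. -/
def coefH (i : Fin r) : MvLaurent k n := .single (Pi.single (D.w i) (D.m i)) (D.γ i : k)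

/-- The image of `x_i`. -/
def imX (i : Fin r) : QWA k n d q := evalAll (D.coefX i) * xyPow (D.w i) (sgn (D.τ i))

/-- The image of `y_i`. -/
def imY (i : Fin r) : QWA k n d q := xyPow (D.w i) (-sgn (D.τ i)) * evalAll (D.coefY i)

/-- The image of `h_i`. -/
def imH (i : Fin r) : (QWA k n d q)ˣ := scalarUnit (D.γ i) * h (D.w i) ^ D.m i

theorem imH_val (i : Fin r) : ((D.imH i : (QWA k n d q)ˣ) : QWA k n d q) = evalAll (D.coefH i) := by
  rw [coefH, evalAll_single, hMon_single, Algebra.smul_def]; rfl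

theorem deg_neg (i : Fin r) : -D.deg i = Pi.single (D.w i) (-sgn (D.τ i)) := by
  rw [deg, Pi.single_neg]

theorem imY_eq (i : Fin r) : (D.imY i : QWA k n d q) =
    evalAll (twist q (-D.deg i) (D.coefY i)) * xyPow (D.w i) (-sgn (D.τ i)) := by
  rw [imY, deg_neg]; exact isWeight_xyPow_neg_sgn _ _ _

theorem coefX_mul_coefY (i : Fin r) :
    D.coefX i * D.coefY i = incl (D.w i) (D.p i * D.p' i) := by
  have hb : (D.b i : k) ≠ 0 := (D.b i).ne_zero
  have ht : D.t i + (fun j ↦ -D.t i j) = 0 := by ext j; simp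
  rw [coefX, coefY, smul_mul_smul_comm, mul_inv_cancel₀ hb, one_smul, mul_mul_mul_comm,
    AddMonoidAlgebra.single_mul_single, ht, mul_one, ← AddMonoidAlgebra.one_def, mul_one, map_mul]

theorem implements_iff {qt : Fin r → kˣ} (ψ : QWA k r d qt →ₐ[k] QWA k n d q) :
    D.Implements ψ ↔ (∀ i, ψ (h i : (QWA k r d qt)ˣ) = (D.imH i : (QWA k n d q)ˣ)) ∧
      (∀ i, ψ (x i) = D.imX i) ∧ ∀ i, ψ (y i) = D.imY i := by
  have eH : ∀ i, ((D.imH i : (QWA k n d q)ˣ) : QWA k n d q) =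
      (D.γ i : k) • (((h (D.w i)) ^ D.m i : (QWA k n d q)ˣ) : QWA k n d q) :=
    fun i ↦ by rw [Algebra.smul_def]; rfl
  have eX : ∀ i, (D.imX i : QWA k n d q) = evalH (D.w i) (D.p i) * ((D.b i : k) • hMon (D.t i)) *
        (x (D.w i) ^ (1 - (D.τ i : ℕ)) * y (D.w i) ^ (D.τ i : ℕ)) := fun i ↦ by
    rw [x_pow_mul_y_pow, imX, coefX, map_smul, map_mul, evalAll_single, one_smul, evalH_eq,
      mul_smul_comm]
  have eY : ∀ i, (D.imY i : QWA k n d q) =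
      (x (D.w i) ^ (D.τ i : ℕ) * y (D.w i) ^ (1 - (D.τ i : ℕ))) *
        evalH (D.w i) (D.p' i) * (((D.b i)⁻¹ : k) • hMon fun j => -D.t i j) := fun i ↦ by
    rw [x_pow_mul_y_pow', imY, coefY, map_smul, map_mul, evalAll_single, one_smul, evalH_eq,
      mul_assoc, mul_smul_comm _ (evalAll _)]
  constructor
  · rintro ⟨h1, h2, h3⟩
    exact ⟨fun i ↦ (h1 i).trans (eH i).symm, fun i ↦ (h2 i).trans (eX i).symm,
      fun i ↦ (h3 i).trans (eY i).symm⟩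
  · rintro ⟨h1, h2, h3⟩
    exact ⟨fun i ↦ (h1 i).trans (eH i), fun i ↦ (h2 i).trans (eX i), fun i ↦ (h3 i).trans (eY i)⟩

variable {D} {qt : Fin r → kˣ}

theorem Admissible.isFamily (hD : D.Admissible d qt q) :
    IsFamily r d qt (D.imX : Fin r → QWA k n d q) D.imY D.imH := by
  have hX : ∀ i, IsWeight (D.deg i) (xyPow (D.w i) (sgn (D.τ i)) : QWA k n d q) :=
    fun i ↦ isWeight_xyPow_sgn _ _
  have hY : ∀ i, IsWeight (-D.deg i) (xyPow (D.w i) (-sgn (D.τ i)) : QWA k n d q) :=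
    fun i ↦ by rw [deg_neg]; exact isWeight_xyPow_neg_sgn _ _
  have hw : ∀ {i l}, i ≠ l → D.w i ≠ D.w l := fun hil e ↦ hil (D.w.injective e)
  have hdeg : ∀ {i l}, i ≠ l → D.deg i (D.w l) = 0 := fun hil ↦ Pi.single_eq_of_ne (hw hil).symm _
  have hdeg' : ∀ {i l}, i ≠ l → (-D.deg i) (D.w l) = 0 := fun hil ↦ by simp [hdeg hil]
  have tH : ∀ i, twist q (D.deg i) (D.coefH i) = (qt i : k) • D.coefH i := fun i ↦ by
    rw [coefH, twist_single_single, deg, Pi.single_eq_same, ← hD.q_pow i]; rfl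
  have tH' : ∀ i, twist q (-D.deg i) (D.coefH i) = ((qt i)⁻¹ : k) • D.coefH i := fun i ↦ by
    rw [coefH, twist_single_single, deg_neg, Pi.single_eq_same, neg_mul, zpow_neg,
      Units.val_inv_eq_inv_val, ← hD.q_pow i]; rfl
  have tHl : ∀ {i l}, i ≠ l → ∀ s : ℤ, twist q (Pi.single (D.w i) s) (D.coefH l) = D.coefH l :=
    fun hil s ↦ by
      rw [coefH, twist_single_single, Pi.single_eq_of_ne (hw hil).symm, zero_mul, zpow_zero,
        Units.val_one, one_smul]
  have hcompat : ∀ i l, chi q (D.deg i) (D.t l) = chi q (D.deg l) (D.t i) := fun i l ↦ by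
    have := (zpow_compat_iff _ _ _ _ _ _).1 (hD.compat i l)
    rw [deg, deg, chi_single_left, chi_single_left, this]
  have chi_neg_left : ∀ v s, chi q (-v) s = (chi q v s)⁻¹ := fun v s ↦ by
    rw [eq_inv_iff_mul_eq_one, ← chi_add_left, neg_add_cancel, chi_zero_left]
  have chi_neg_right : ∀ v s, chi q v (fun j ↦ -s j) = (chi q v s)⁻¹ := fun v s ↦ by
    change chi q v (-s) = _
    rw [eq_inv_iff_mul_eq_one, ← chi_add_right, neg_add_cancel, chi_zero_right]
  have tX : ∀ {i l}, i ≠ l → twist q (D.deg i) (D.coefX l) =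
      (chi q (D.deg i) (D.t l) : k) • D.coefX l :=
    fun hil ↦ twist_smul_incl_mul_single (hdeg hil) _ _ _
  have tX' : ∀ {i l}, i ≠ l → twist q (-D.deg i) (D.coefX l) =
      ((chi q (D.deg i) (D.t l))⁻¹ : kˣ) • D.coefX l := fun {i l} hil ↦ by
    rw [← chi_neg_left]; exact twist_smul_incl_mul_single (hdeg' hil) _ _ _
  have tY : ∀ {i l}, i ≠ l → twist q (D.deg i) (twist q (-D.deg l) (D.coefY l)) =
      ((chi q (D.deg i) (D.t l))⁻¹ : kˣ) • twist q (-D.deg l) (D.coefY l) := fun {i l} hil ↦ by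
    rw [twist_comm, coefY, twist_smul_incl_mul_single (hdeg hil), chi_neg_right, map_smul]; rfl
  have tY' : ∀ {i l}, i ≠ l → twist q (-D.deg i) (twist q (-D.deg l) (D.coefY l)) =
      (chi q (D.deg i) (D.t l) : k) • twist q (-D.deg l) (D.coefY l) := fun {i l} hil ↦ by
    rw [twist_comm, coefY, twist_smul_incl_mul_single (hdeg' hil), chi_neg_right, chi_neg_left,
      inv_inv, map_smul]
  have hfac : ∀ i, D.coefX i * D.coefY i * incl (D.w i) (sideFactor d (q (D.w i)) (D.τ i)) =
      aD d ((qt i : k) • D.coefH i) := fun i ↦ by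
    rw [coefX_mul_coefY, ← map_mul, hD.factor i, incl_aD, coefH, AddMonoidAlgebra.smul_single,
      smul_eq_mul]
  constructor
  · intro i
    rw [imH_val, imX, mul_assoc, hX, tH, map_smul, smul_mul_assoc, mul_smul_comm, ← mul_assoc,
      ← mul_assoc, ← map_mul, ← map_mul, mul_comm]
  · intro i
    rw [imH_val, imY_eq, mul_assoc, hY, tH', map_smul, smul_mul_assoc, mul_smul_comm, ← mul_assoc,
      ← mul_assoc, ← map_mul, ← map_mul, mul_comm]
  · intro i
    rw [imH_val, imX, imY, mul_assoc, ← mul_assoc (xyPow _ _), xyPow_sgn_mul_neg_sgn, ← map_mul,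
      ← map_mul, mul_comm (incl _ _), ← mul_assoc, hfac, map_aD, map_smul]
  · intro i
    have e : (D.imY i * D.imX i : QWA k n d q) = xyPow (D.w i) (-sgn (D.τ i)) *
        evalAll (D.coefX i * D.coefY i) * xyPow (D.w i) (sgn (D.τ i)) := by
      rw [imX, imY, mul_comm (D.coefX i), map_mul]
      simp only [mul_assoc]
    rw [e, hY, mul_assoc, xyPow_neg_sgn_mul_sgn, ← deg_neg, ← map_mul, ← map_mul, hfac, map_aD,
      map_aD, imH_val, map_smul, tH', smul_smul, mul_inv_cancel₀ (qt i).ne_zero, one_smul]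
  · intro i l hil
    rw [imH_val, imH_val, ← map_mul, ← map_mul, mul_comm]
  · intro i l hil
    rw [imH_val, imX, mul_assoc, hX, deg, tHl hil.symm, ← mul_assoc, ← mul_assoc, ← map_mul,
      ← map_mul, mul_comm]
  · intro i l hil
    rw [imH_val, imY_eq, mul_assoc, hY, deg_neg, tHl hil.symm, ← mul_assoc, ← mul_assoc, ← map_mul,
      ← map_mul, mul_comm]
  · intro i l hil
    exact commute_evalAll_mul (hX i) (hX l) (commute_xyPow_xyPow (hw hil) _ _) (tX hil)
      (by rw [hcompat]; exact tX hil.symm)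
  · intro i l hil
    rw [imY_eq]
    exact commute_evalAll_mul (hX i) (hY l) (commute_xyPow_xyPow (hw hil) _ _) (tY hil)
      (by rw [hcompat]; exact tX' hil.symm)
  · intro i l hil
    rw [imY_eq, imY_eq]
    exact commute_evalAll_mul (hY i) (hY l) (commute_xyPow_xyPow (hw hil) _ _) (tY' hil)
      (by rw [hcompat]; exact tY' hil.symm)

theorem Admissible.existsUnique (hD : D.Admissible d qt q) :
    ∃! ψ : QWA k r d qt →ₐ[k] QWA k n d q, D.Implements ψ := by
  refine ⟨liftHom _ _ _ hD.isFamily, (D.implements_iff _).2 ⟨fun i ↦ liftHom_h _ _ _ _ i,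
    fun i ↦ liftHom_x _ _ _ _ i, fun i ↦ liftHom_y _ _ _ _ i⟩, fun ψ hψ ↦ ?_⟩
  obtain ⟨h1, h2, h3⟩ := (D.implements_iff ψ).1 hψ
  exact hom_ext (fun i ↦ (h2 i).trans (liftHom_x _ _ _ _ i).symm)
    (fun i ↦ (h3 i).trans (liftHom_y _ _ _ _ i).symm)
    (fun i ↦ (h1 i).trans (liftHom_h _ _ _ _ i).symm)

end HomDatum

end QWA

namespace MvLaurent

open AddMonoidAlgebra

variable {k : Type*} [Field k] {n d : ℕ}

theorem aD_single_eq_zero (hd : 0 < d) {M : Fin n → ℤ} {a : k}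
    (h : aD d (single M a : MvLaurent k n) = 0) : M = 0 ∧ a ^ d = 1 := by
  classical
  rw [aD, single_pow, sub_eq_zero, one_def] at h
  have h1 := congrArg (fun F ↦ coeff F 0) h
  simp only [coeff_single, Finsupp.single_eq_same, Finsupp.single_apply] at h1
  split_ifs at h1 with hM
  · refine ⟨?_, h1⟩
    ext i
    have := congrFun hM i
    simp only [Pi.smul_apply, Pi.zero_apply, nsmul_eq_mul, mul_eq_zero, Nat.cast_eq_zero] at this ⊢
    omega
  · exact absurd h1 zero_ne_one

theorem spec_aD_single_eq_zero (hd : 0 < d) {j : Fin n} {e a : kˣ} {M : Fin n → ℤ}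
    (h : spec j e (aD d (single M (a : k))) = 0) : forget j M = 0 ∧ (a * e ^ M j) ^ d = 1 := by
  rw [map_aD, spec_single, ← Units.val_mul] at h
  obtain ⟨h1, h2⟩ := aD_single_eq_zero hd h
  exact ⟨h1, Units.ext (by rw [Units.val_pow_eq_pow_val, h2, Units.val_one])⟩

theorem eq_single_of_forget_eq_zero {j : Fin n} {M : Fin n → ℤ} (h : forget j M = 0) :
    M = Pi.single j (M j) := by
  conv_lhs => rw [← single_add_forget j M, h, add_zero]

end MvLaurent

namespace QWA

open MvLaurent QTorus

variable {k : Type*} [Field k] {n d : ℕ} {q : Fin n → kˣ}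

/-- The factors of a nonzero Laurent polynomial in `h_1, …, h_n` are homogeneous. -/
theorem exists_toTorus_eq_mono {a b : QWA k n d q} {P P' : MvLaurent k n} (hP : P ≠ 0)
    (hab : a * b = evalAll P) (hba : b * a = evalAll P') :
    ∃ v f g, toTorus a = mono q v f ∧ toTorus b = mono q (-v) g ∧ f * twist q v g = P ∧
      g * twist q (-v) f = P' := by
  have h1 := congrArg toTorus hab
  have h2 := congrArg toTorus hba
  rw [map_mul, toTorus_evalAll] at h1 h2
  obtain ⟨v, w, f, g, ha, hb, hvw, -⟩ :=
    SkewMonoidAlgebra.exists_single_of_mul_eq_single hP h1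
  obtain ⟨v, rfl⟩ := Torus.of_surjective v
  obtain ⟨w, rfl⟩ := Torus.of_surjective w
  rw [← Torus.of_add] at hvw
  obtain rfl := eq_neg_of_add_eq_zero_right (Torus.of_injective hvw)
  change toTorus a = mono q v f at ha
  change toTorus b = mono q (-v) g at hb
  rw [ha, hb, mono_mul_mono] at h1 h2
  rw [add_neg_cancel] at h1
  rw [neg_add_cancel] at h2
  exact ⟨v, f, g, ha, hb, mono_injective _ h1, mono_injective _ h2⟩

theorem exists_units_eq (hd : 0 < d) (u : (QWA k n d q)ˣ) :
    ∃ M, ∃ γ : kˣ, (u : QWA k n d q) = evalAll (.single M (γ : k)) := by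
  obtain ⟨v, f, g, hf, hg, hfg, hgf⟩ := exists_toTorus_eq_mono (P := 1) (P' := 1) one_ne_zero
    (by rw [u.mul_inv, map_one]) (by rw [u.inv_mul, map_one])
  have hv : v = 0 := by
    by_contra hv
    obtain ⟨j, hj⟩ := Function.ne_iff.1 hv
    rcases lt_or_gt_of_ne hj with hj | hj
    · have h1 := congrArg (spec j 1) hfg
      rw [map_mul, spec_one_eq_zero hd hf hj, zero_mul, map_one] at h1
      exact zero_ne_one h1
    · have h1 := congrArg (spec j 1) hgf
      rw [map_mul, spec_one_eq_zero hd hg (by simpa using hj), zero_mul, map_one] at h1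
      exact zero_ne_one h1
  subst hv
  rw [twist_zero] at hfg
  obtain ⟨M, γ, rfl⟩ := exists_single_of_mul_eq_one hfg
  exact ⟨M, γ, toTorus_injective hd (by rw [hf, toTorus_evalAll])⟩

/-- The shape of three elements that satisfy the defining relations of `A(1, d, c)`. -/
theorem exists_form_of_relations (hd : 0 < d) {X Y : QWA k n d q} {H : (QWA k n d q)ˣ} {c : kˣ}
    (hc : c ^ d ≠ 1) (xh : X * H = (c : k) • (H * X : QWA k n d q))
    (xy : X * Y = aD d ((c : k) • (H : QWA k n d q))) (yx : Y * X = aD d (H : QWA k n d q)) :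
    ∃ (j : Fin n) (τ : Fin 2) (m : ℤ) (γ : kˣ) (t : Fin n → ℤ) (p p' : k[T;T⁻¹]),
      m ≠ 0 ∧ q j ^ (sgn τ * m) = c ∧
      p * p' * sideFactor d (q j) τ =
        aD d (LaurentPolynomial.C ((c : k) * (γ : k)) * LaurentPolynomial.T m) ∧
      γ ^ d = c ^ (-(((τ : ℕ) : ℤ) * (d : ℤ))) ∧
      (H : QWA k n d q) = evalAll (.single (Pi.single j m) (γ : k)) ∧
      X ≠ 0 ∧
      X = evalAll (incl j p * .single t 1) * xyPow j (sgn τ) ∧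
      Y = xyPow j (-sgn τ) * evalAll (incl j p' * .single (-t) 1) := by
  have hc1 : c ≠ 1 := by rintro rfl; exact hc (one_pow d)
  obtain ⟨M, γ, hH⟩ := exists_units_eq hd H
  have hcH : (c : k) • (H : QWA k n d q) = evalAll (.single M ((c * γ : kˣ) : k)) := by
    rw [hH, ← map_smul, AddMonoidAlgebra.smul_single, smul_eq_mul, Units.val_mul]
  rw [hcH, ← map_aD] at xy
  rw [hH, ← map_aD] at yx
  have hM : M ≠ 0 := by
    rintro rfl
    have hX : X = 0 := by
      rw [hH, evalAll_single, hMon_zero, mul_smul_one, smul_one_mul, smul_smul, ← sub_eq_zero,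
        ← sub_smul, smul_eq_zero] at xh
      refine xh.resolve_left fun h ↦ hc1 (Units.ext ?_)
      rw [sub_eq_zero] at h
      exact (mul_eq_right₀ γ.ne_zero).1 h.symm
    rw [hX, zero_mul, ← map_zero evalAll] at xy
    rw [hX, mul_zero, ← map_zero evalAll] at yx
    have h1 := (aD_single_eq_zero hd (evalAll_injective xy).symm).2
    have h2 := (aD_single_eq_zero hd (evalAll_injective yx).symm).2
    rw [Units.val_mul, mul_pow, h2, mul_one] at h1
    exact hc (Units.ext (by rw [Units.val_pow_eq_pow_val, h1, Units.val_one]))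
  have hP : aD d (.single M ((c * γ : kˣ) : k) : MvLaurent k n) ≠ 0 :=
    fun h ↦ hM (aD_single_eq_zero hd h).1
  obtain ⟨v, f, g, hf, hg, hfg, hgf⟩ := exists_toTorus_eq_mono hP xy yx
  have hf0 : f ≠ 0 := by rintro rfl; exact hP (by rw [← hfg, zero_mul])
  have hX0 : X ≠ 0 := by
    rintro rfl
    rw [map_zero] at hf
    exact hf0 (mono_injective v (hf.symm.trans (SkewMonoidAlgebra.single_zero _).symm))
  have hchi : chi q v M = c := by
    have h1 := congrArg toTorus xh
    rw [map_smul, map_mul, map_mul, hH, toTorus_evalAll, hf, mono_mul_mono, mono_mul_mono, add_zero,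
      zero_add, smul_mono] at h1
    have h2 := mono_injective _ h1
    have hη : (.single M (γ : k) : MvLaurent k n) ≠ 0 := by simp
    have h3 : twist q v (.single M (γ : k)) =
        (chi q v M : k) • (.single M (γ : k) : MvLaurent k n) := by
      rw [twist_single, AddMonoidAlgebra.smul_single, smul_eq_mul, mul_comm]
    rw [h3, twist_zero, AlgHom.id_apply, mul_smul_comm, mul_comm f] at h2
    exact Units.ext (smul_left_injective k (mul_ne_zero hη hf0) h2)
  have hpos : ∀ {j}, 0 < v j → forget j M = 0 ∧ γ ^ d = 1 := fun {j} hj ↦ by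
    have h1 := congrArg (spec j 1) hgf
    rw [map_mul, spec_one_eq_zero hd hg (by simpa using hj), zero_mul] at h1
    simpa using spec_aD_single_eq_zero hd h1.symm
  have hneg : ∀ {j}, v j < 0 → forget j M = 0 ∧ (c * γ) ^ d = 1 := fun {j} hj ↦ by
    have h1 := congrArg (spec j 1) hfg
    rw [map_mul, spec_one_eq_zero hd hf hj, zero_mul] at h1
    simpa only [one_zpow, mul_one] using spec_aD_single_eq_zero hd h1.symm
  have hne : ∀ {j}, v j ≠ 0 → forget j M = 0 := fun hj ↦
    (lt_or_gt_of_ne hj).elim (fun h ↦ (hneg h).1) fun h ↦ (hpos h).1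
  obtain ⟨j, hj⟩ : ∃ j, v j * M j ≠ 0 := by
    by_contra! h
    refine hc1 (hchi.symm.trans (Finset.prod_eq_one fun j _ ↦ ?_))
    rw [h, zpow_zero]
  have hvj : v j ≠ 0 := left_ne_zero_of_mul hj
  have hMj : M j ≠ 0 := right_ne_zero_of_mul hj
  have hMs : M = Pi.single j (M j) := eq_single_of_forget_eq_zero (hne hvj)
  have hv : v = Pi.single j (v j) := by
    refine eq_single_of_forget_eq_zero ?_
    ext i
    rcases eq_or_ne i j with rfl | hij
    · simp [forget]
    · have : forget j v i = v i := Function.update_of_ne hij _ _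
      rw [this, Pi.zero_apply]
      by_contra hvi
      have := eq_single_of_forget_eq_zero (hne hvi)
      exact hMj (by rw [this, Pi.single_eq_of_ne hij.symm])
  have hchi' : q j ^ (v j * M j) = c := by
    rw [← hchi, hMs, chi_single_right, Pi.single_eq_same]
  have hroot : (q j ^ M j) ^ d ≠ 1 := fun h ↦ hc <| by
    rw [← hchi', mul_comm, zpow_mul, ← zpow_natCast, zpow_comm, zpow_natCast, h, one_zpow]
  have hle : v j ≤ 1 := by
    by_contra! hlt
    have h1 := congrArg (spec j (q j)) hgf
    rw [map_mul, spec_q_eq_zero hd hg (by simpa using hlt), zero_mul] at h1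
    have h2 := (spec_aD_single_eq_zero hd h1.symm).2
    rw [mul_pow, (hpos (zero_lt_one.trans hlt)).2, one_mul] at h2
    exact hroot h2
  have hge : -1 ≤ v j := by
    by_contra! hlt
    have h1 := congrArg (spec j (q j)) hfg
    rw [map_mul, spec_q_eq_zero hd hf hlt, zero_mul] at h1
    have h2 := (spec_aD_single_eq_zero hd h1.symm).2
    rw [mul_pow, (hneg (hlt.trans neg_one_lt_zero)).2, one_mul] at h2
    exact hroot h2
  obtain ⟨τ, hτ, hγ⟩ : ∃ τ : Fin 2, v j = sgn τ ∧ γ ^ d = c ^ (-(((τ : ℕ) : ℤ) * (d : ℤ))) := by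
    rcases lt_or_gt_of_ne hvj with h | h
    · refine ⟨1, by rw [sgn_one]; omega, ?_⟩
      have := (hneg h).2
      rw [mul_pow, mul_comm] at this
      rw [eq_inv_of_mul_eq_one_left this]
      simp
    · refine ⟨0, by rw [sgn_zero]; omega, ?_⟩
      rw [(hpos h).2]
      simp
  rw [hτ] at hv hchi'
  obtain ⟨a, hXa⟩ := exists_evalAll_mul_xyMon hd hf
  obtain ⟨b, hYb⟩ := exists_evalAll_mul_xyMon hd hg
  rw [hv, xyMon_single] at hXa
  rw [hv, ← Pi.single_neg, xyMon_single] at hYb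
  have hYb' : Y = xyPow j (-sgn τ) * evalAll (twist q (Pi.single j (sgn τ)) b) := by
    rw [isWeight_xyPow_neg_sgn, Pi.single_neg, twist_neg_twist, hYb]
  have hab : a * twist q (Pi.single j (sgn τ)) b * incl j (sideFactor d (q j) τ) =
      incl j (aD d (LaurentPolynomial.C ((c : k) * (γ : k)) * LaurentPolynomial.T (M j))) := by
    refine evalAll_injective (d := d) (q := q) ?_
    rw [incl_aD j d _ (M j), ← hMs, ← Units.val_mul, ← xy, hYb', hXa, mul_assoc (evalAll a),
      ← mul_assoc (xyPow _ _), xyPow_sgn_mul_neg_sgn, ← map_mul, ← map_mul, mul_assoc a,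
      mul_comm (incl j _)]
  obtain ⟨p, p', t, ha, hb, hpp⟩ := exists_incl_of_mul_eq_incl j (by
    intro h
    refine hP ?_
    have := congrArg (incl j) h
    rwa [incl_aD, ← hMs, map_zero, ← Units.val_mul] at this) hab
  exact ⟨j, τ, M j, γ, t, p, p', hMj, hchi', hpp, hγ, by rw [← hMs]; exact hH, hX0, by rw [hXa, ha],
    by rw [hYb', hb]⟩

theorem exists_admissible {r : ℕ} (hd : 0 < d) {qt : Fin r → kˣ} (hqt : ∀ i, qt i ^ d ≠ 1)
    (ψ : QWA k r d qt →ₐ[k] QWA k n d q) :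
    ∃ D : HomDatum k r n, D.Admissible d qt q ∧ D.Implements ψ := by
  have hR := isFamily_gens (k := k) (d := d) (q := qt)
  have hform := fun i ↦ exists_form_of_relations hd (hqt i) (X := ψ (x i)) (Y := ψ (y i))
    (H := Units.map (ψ : QWA k r d qt →* QWA k n d q) (h i))
    (by simpa using congrArg ψ (hR.xh i)) (by simpa [map_aD] using congrArg ψ (hR.xy i))
    (by simpa [map_aD] using congrArg ψ (hR.yx i))
  choose w τ m γ t p p' hm hq hfac hγ hH hX0 hX hY using hform
  replace hH : ∀ i, ψ (h i : (QWA k r d qt)ˣ) = evalAll (.single (Pi.single (w i) (m i)) (γ i : k)) :=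
    hH
  have hα : ∀ i, incl (w i) (p i) * .single (t i) 1 ≠ (0 : MvLaurent k n) := fun i h ↦
    hX0 i (by rw [hX, h, map_zero, zero_mul])
  have hw : Function.Injective w := by
    intro i l hil
    by_contra hne
    have h1 := congrArg ψ (hR.comm_hx l i (Ne.symm hne))
    rw [map_mul, map_mul, hH, hX, mul_assoc, isWeight_xyPow_sgn, ← mul_assoc, ← mul_assoc, ← map_mul,
      ← map_mul] at h1
    have h2 := evalAll_mul_right_cancel (isMono_toTorus_xyPow hd _ _) h1
    rw [twist_single_single, ← hil, Pi.single_eq_same, mul_smul_comm, mul_comm] at h2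
    have h3 : (.single (Pi.single (w i) (m l)) (γ l : k) : MvLaurent k n) ≠ 0 := by simp
    have h4 : ((1 : kˣ) : k) = ((q (w i) ^ (sgn (τ i) * m l) : kˣ) : k) :=
      smul_left_injective k (mul_ne_zero (hα i) h3) (by simpa using h2)
    have h5 : q (w i) ^ m l = 1 := by
      have := (Units.ext h4).symm
      generalize τ i = s at this
      fin_cases s <;> simpa [sgn] using this
    refine hqt l ?_
    rw [← hq l, ← hil, mul_comm, zpow_mul, h5, one_zpow, one_pow]
  refine ⟨⟨⟨w, hw⟩, τ, m, t, γ, fun _ ↦ 1, p, p'⟩, ⟨hm, hq, fun i l ↦ ?_, hfac, hγ⟩, ?_⟩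
  · refine (zpow_compat_iff _ _ _ _ _ _).2 ?_
    change q (w i) ^ (sgn (τ i) * t l (w i)) = q (w l) ^ (sgn (τ l) * t i (w l))
    rcases eq_or_ne i l with rfl | hil
    · rfl
    have hwil : w i ≠ w l := fun e ↦ hil (hw e)
    have h1 := congrArg ψ (hR.comm_xx i l hil)
    have e : ∀ (A B : MvLaurent k n) (c : k) (u u' : QWA k n d q),
        evalAll A * (evalAll (c • B) * u * u') = evalAll (c • (A * B)) * (u * u') := by
      intros
      simp only [map_smul, map_mul, smul_mul_assoc, mul_smul_comm, mul_assoc]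
    have key : ∀ {i l}, w i ≠ w l → ψ (x i) * ψ (x l) =
        evalAll (((q (w i) ^ (sgn (τ i) * t l (w i)) : kˣ) : k) •
          ((incl (w i) (p i) * .single (t i) 1) * (incl (w l) (p l) * .single (t l) 1))) *
        (xyPow (w i) (sgn (τ i)) * xyPow (w l) (sgn (τ l))) := fun {i l} hil ↦ by
      have h2 := twist_smul_incl_mul_single (q := q) (v := Pi.single (w i) (sgn (τ i))) (j := w l)
        (Pi.single_eq_of_ne hil.symm _) (1 : k) (p l) (t l)
      rw [one_smul, chi_single_left] at h2
      rw [hX, hX, mul_assoc, ← mul_assoc (xyPow _ _), isWeight_xyPow_sgn, h2]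
      exact e _ _ _ _ _
    rw [map_mul, map_mul, key hwil, key hwil.symm, (commute_xyPow_xyPow hwil _ _).eq,
      mul_comm (incl (w l) _ * _)] at h1
    have h2 := evalAll_mul_right_cancel (v := Pi.single (w l) (sgn (τ l)) + Pi.single (w i) (sgn (τ i)))
      (by rw [map_mul]; exact (isMono_toTorus_xyPow hd _ _).mul (isMono_toTorus_xyPow hd _ _)) h1
    exact Units.ext (smul_left_injective k (mul_ne_zero (hα i) (hα l)) h2)
  · rw [HomDatum.implements_iff]
    refine ⟨fun i ↦ ?_, fun i ↦ ?_, fun i ↦ ?_⟩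
    · rw [hH, HomDatum.imH_val]; rfl
    · rw [hX, HomDatum.imX, HomDatum.coefX]
      simp
    · rw [hY, HomDatum.imY, HomDatum.coefY]
      simp
      rfl

end QWA

end

theorem theorem3p1 {k : Type*} [Field k] (n r d : ℕ) (hr : 0 < r) (hrn : r ≤ n) (hd : 0 < d)
    (q : Fin n → kˣ) (hq : ∀ j, q j ^ d ≠ 1) (qt : Fin r → kˣ) (hqt : ∀ i, qt i ^ d ≠ 1) :
    (∀ ψ : QWA k r d qt →ₐ[k] QWA k n d q,
      ∃ D : QWA.HomDatum k r n, D.Admissible d qt q ∧ D.Implements ψ) ∧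
    (∀ D : QWA.HomDatum k r n, D.Admissible d qt q →
      ∃! ψ : QWA k r d qt →ₐ[k] QWA k n d q, D.Implements ψ) :=
  ⟨fun ψ ↦ QWA.exists_admissible hd hqt ψ, fun _ hD ↦ hD.existsUnique⟩
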